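/- Let $(X,\mu)$ be an atomless standard probability space. $\mathrm{Aut}(\mu)$ and $\mathrm{Aut}(\mu\otimes\mu)$ denote the groups of invertible measure-preserving transformations (automorphisms) of $(X,\mu)$ and of $(X\times X,\mu\otimes\mu)$, modulo null sets. $\mathrm{Aut}(\mu\otimes\mu)$ carries the Halmos metric $$\rho(R,T)=\sum_i 2^{-i}\bigl((\mu\otimes\mu)(RA_i\,\triangle\, TA_i)+(\mu\otimes\mu)(R^{-1}A_i\,\triangle\, T^{-1}A_i)\bigr),$$ where $\{A_i\}$ is any fixed sequence of measurable sets dense in the measure algebra of $\mu\otimes\mu$. For $S\in\mathrm{Aut}(\mu)$ let $\mathrm{Ext}(S)\subset\mathrm{Aut}(\mu\otimes\mu)$ be the set of all skew products $R(x,y)=(Sx,R_xy)$, where $\{R_x\}$ is a measurable family of automorphisms of $(X,\mu)$, with the induced topology, and put $\mathbf J=\mathrm{Ext}(\mathrm{Id})$. For an automorphism $R$ and $f\in L_2$ (complex), acting by $Rf=f\circ R$, the spectral measure $\sigma_{f,R}$ is the finite measure on the unit circle $\mathbf T$ with $\int_{\mathbf T}z^s\,d\sigma_{f,R}=(R^sf,f)$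 for all $s\in\mathbf Z$. We say that $R$ has singular spectrum if $\sigma_{f,R}$ is singular with respect to Lebesgue measure on $\mathbf T$ for every $f\in L_2$. Theorem. The automorphisms with singular spectrum form a $G_\delta$ subset $\mathrm{Sing}$ of $\mathrm{Aut}(\mu\otimes\mu)$. Moreover, let $S\in\mathrm{Aut}(\mu)$ have singular spectrum. Then: 1. the generic extension of $S$ has singular spectrum, that is, there is a dense $G_\delta$ subset $W$ of $\mathrm{Ext}(S)$ such that every $R\in W$ has singular spectrum; 2. the class $\{J^{-1}(S\times\mathrm{Id})J : J\in\mathbf J\}$ is contained in $\mathrm{Ext}(S)\cap\mathrm{Sing}$; 3. if $S$ is ergodic, this class is dense in $\mathrm{Ext}(S)$. -/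

import Mathlib

open MeasureTheory Set Filter Topology symmDiff

namespace ErgodicExt

/-! ## The group of automorphisms of a measure space, modulo null sets -/

section Automorphisms

variable {Z : Type*} [MeasurableSpace Z]

/-- Everywhere defined invertible bimeasurable maps of `Z` that preserve `ν`. -/
def MPEquiv (ν : Measure Z) : Type _ := {e : Z ≃ᵐ Z // MeasurePreserving e ν ν}

variable {ν : Measure Z}

/-- The group law is composition: `(f * g) z = f (g z)`. -/
instance : Group (MPEquiv ν) where
  mul f g := ⟨g.1.trans f.1, f.2.comp g.2⟩
  one := ⟨MeasurableEquiv.refl Z, MeasurePreserving.id ν⟩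
  inv f := ⟨f.1.symm, f.2.symm f.1⟩
  mul_assoc _ _ _ := rfl
  one_mul _ := rfl
  mul_one _ := rfl
  inv_mul_cancel f := Subtype.ext (MeasurableEquiv.ext (funext fun z => f.1.symm_apply_apply z))

/-- Two maps are identified when they agree almost everywhere; this is a congruence. -/
def aeCon (ν : Measure Z) : Con (MPEquiv ν) where
  r f g := ∀ᵐ z ∂ν, f.1 z = g.1 z
  iseqv :=
    { refl := fun _ => Eventually.of_forall fun _ => rfl
      symm := fun h => h.mono fun _ hz => hz.symm
      trans := fun h k => by filter_upwards [h, k] with z h1 h2 using h1.trans h2 }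
  mul' := by
    intro f f' g g' hf hg
    have h1 : ∀ᵐ z ∂ν, f.1 (g.1 z) = f'.1 (g.1 z) := g.2.quasiMeasurePreserving.ae hf
    filter_upwards [h1, hg] with z h1 h2
    change f.1 (g.1 z) = f'.1 (g'.1 z)
    rw [h1, h2]

/-- The group `Aut(ν)` of automorphisms of the measure space `(Z, ν)`, modulo null sets. -/
def Aut (ν : Measure Z) : Type _ := (aeCon ν).Quotient

noncomputable instance : Group (Aut ν) := inferInstanceAs (Group (aeCon ν).Quotient)

/-- The class of an everywhere defined measure-preserving invertible map. -/
def Aut.mk (e : MPEquiv ν) : Aut ν := (e : (aeCon ν).Quotient)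

/-- A representative of an automorphism. All the notions below depend on it only
up to almost everywhere equality. -/
noncomputable def Aut.rep (R : Aut ν) : MPEquiv ν := Quotient.out (s := (aeCon ν).toSetoid) R

theorem Aut.mk_rep (R : Aut ν) : Aut.mk R.rep = R := Quotient.out_eq (s := (aeCon ν).toSetoid) R

theorem Aut.mk_eq_mk {e e' : MPEquiv ν} : Aut.mk e = Aut.mk e' ↔ ∀ᵐ z ∂ν, e.1 z = e'.1 z :=
  (aeCon ν).eq

theorem Aut.rep_mk (e : MPEquiv ν) : ∀ᵐ z ∂ν, (Aut.mk e).rep.1 z = e.1 z :=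
  Aut.mk_eq_mk.1 (Aut.mk_rep (Aut.mk e))

noncomputable instance : CoeFun (Aut ν) (fun _ => Z → Z) := ⟨fun R => R.rep.1⟩

theorem Aut.measurePreserving (R : Aut ν) : MeasurePreserving R ν ν := R.rep.2

/-! ## The Halmos metric -/

/-- The Halmos distance attached to a sequence of sets `A i`:
`∑ i, 2⁻ⁱ (ν (S Aᵢ ∆ T Aᵢ) + ν (S⁻¹ Aᵢ ∆ T⁻¹ Aᵢ))`. -/
noncomputable def halmosDist (A : ℕ → Set Z) (S T : Aut ν) : ℝ :=
  ∑' i, (1 / 2 : ℝ) ^ i *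
    (ν.real ((S '' A i) ∆ (T '' A i)) + ν.real ((S ⁻¹' A i) ∆ (T ⁻¹' A i)))

theorem halmos_summable [IsProbabilityMeasure ν] (A : ℕ → Set Z) (S T : Aut ν) :
    Summable fun i => (1 / 2 : ℝ) ^ i *
      (ν.real ((S '' A i) ∆ (T '' A i)) + ν.real ((S ⁻¹' A i) ∆ (T ⁻¹' A i))) := by
  refine Summable.of_nonneg_of_le (fun i => by positivity) (fun i => ?_)
    (summable_geometric_two.mul_right 2)
  have h1 : ν.real ((S '' A i) ∆ (T '' A i)) ≤ 1 := measureReal_le_one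
  have h2 : ν.real ((S ⁻¹' A i) ∆ (T ⁻¹' A i)) ≤ 1 := measureReal_le_one
  gcongr
  linarith

theorem symmDiff_real_triangle [IsProbabilityMeasure ν] (s t u : Set Z) :
    ν.real (s ∆ u) ≤ ν.real (s ∆ t) + ν.real (t ∆ u) :=
  (measureReal_mono (symmDiff_triangle s t u)).trans (measureReal_union_le _ _)

/-- The Halmos distance makes `Aut(ν)` a (pseudo)metric space, for every sequence of sets. On a
standard space, points at distance zero coincide as soon as the sequence is dense in the measure
algebra. -/
noncomputable abbrev halmosMetric [IsProbabilityMeasure ν] (A : ℕ → Set Z) :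
    PseudoMetricSpace (Aut ν) where
  dist := halmosDist A
  dist_self S := by simp [halmosDist]
  dist_comm S T := by simp only [halmosDist, symmDiff_comm]
  dist_triangle S T U := by
    rw [halmosDist, halmosDist, halmosDist,
      ← (halmos_summable A S T).tsum_add (halmos_summable A T U)]
    refine (halmos_summable A S U).tsum_le_tsum (fun i => ?_)
      ((halmos_summable A S T).add (halmos_summable A T U))
    have h1 := symmDiff_real_triangle (ν := ν) (S '' A i) (T '' A i) (U '' A i)
    have h2 := symmDiff_real_triangle (ν := ν) (S ⁻¹' A i) (T ⁻¹' A i) (U ⁻¹' A i)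
    rw [← mul_add]
    exact mul_le_mul_of_nonneg_left (by linarith) (by positivity)

/-! ## Spectral measures -/

/-- The Koopman operator `f ↦ f ∘ R` on `L²(ν; ℂ)`. -/
noncomputable def koopman (R : Aut ν) : Lp ℂ 2 ν →ₗᵢ[ℂ] Lp ℂ 2 ν :=
  Lp.compMeasurePreservingₗᵢ ℂ R R.measurePreserving

/-- `σ` is the spectral measure of `R` with cyclic vector `f`: the finite measure on the circle
(parametrized by `t ∈ ℝ/ℤ`, `z = exp (2πit)`) such that `∫ zˢ dσ = (Rˢ f, f)` for all integers `s`.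
(Mathlib's inner product is linear in its second argument.) -/
def IsSpectralMeasure (R : Aut ν) (f : Lp ℂ 2 ν) (σ : Measure UnitAddCircle) : Prop :=
  IsFiniteMeasure σ ∧ ∀ s : ℤ, ∫ t, fourier s t ∂σ = inner ℂ f (koopman (R ^ s) f)

/-- All spectral measures of `R` are singular with respect to the Lebesgue measure on the circle. -/
def HasSingularSpectrum (R : Aut ν) : Prop :=
  ∀ f : Lp ℂ 2 ν, ∃ σ : Measure UnitAddCircle,
    IsSpectralMeasure R f σ ∧ σ ⟂ₘ (volume : Measure UnitAddCircle)

end Automorphisms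

/-! ## Extensions -/

section Extensions

variable {X : Type*} [MeasurableSpace X] {μ : Measure X} [SFinite μ]

/-- `Ext(S)`: the skew products `R (x, y) = (S x, R_x y)` over `S`, where `R_x` is a measurable
family of automorphisms of the fibre. -/
def Ext (S : Aut μ) : Set (Aut (μ.prod μ)) :=
  {R | ∃ r : X → MPEquiv μ, Measurable (fun p : X × X => (r p.1).1 p.2) ∧
    ∀ᵐ p ∂(μ.prod μ), R p = (S p.1, (r p.1).1 p.2)}

/-- The direct product `S × Id`. -/
noncomputable def prodId (S : Aut μ) : Aut (μ.prod μ) :=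
  Aut.mk ⟨MeasurableEquiv.prodCongr S.rep.1 (MeasurableEquiv.refl X),
    S.measurePreserving.prod (MeasurePreserving.id μ)⟩

end Extensions

end ErgodicExt

/-! Singularity is tested with trigonometric polynomials. A finite measure σ on the circle is
singular iff for every ε some polynomial p has |p| ≤ 2, ∫|p|² < ε for Lebesgue measure and ∫|1 - p|²
dσ < ε. Such a p approximates a continuous function separating the two measures; conversely, along ε
= 2⁻ⁿ the polynomials tend to 0 Lebesgue-a.e. and to 1 σ-a.e. If σ is the spectral measure of v
under U, the last integral is ‖v - p(U)v‖², so the criterion (`singVec_iff`) no longer mentions σ.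
For fixed p and v it is an open condition on the automorphism, because powers of the Koopman
operator depend continuously on it; a countable dense set of vectors then gives the Gδ property. The
criterion also shows that vectors with singular spectral measure form a closed subspace, so
singularity need only be checked on suitable indicator functions. For S × Id rectangles suffice,
since the spectral measure of 1_{A×B} is μ(B) times that of 1_A.

For density, let E be an extension of S. Over the aperiodic points of S take a marker set B whose
returns take time at least n. Conjugating S × Id by J = (S × Id)^k E^{-k}, with k the time since the
last visit to B, recovers E except where the next step enters B, a set of measure at most 1/n
(`exists_conj_prodOne`). Over the periodic points of S, E is changed on a set of measure at most 1/n
so that every point becomes periodic (`exists_periodic_modification`); the resulting spectral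
measures live on roots of unity. Gluing the two maps gives an extension with singular spectrum close
to E. If S is ergodic on an atomless space its periodic points form a null set, so the conjugates
alone are dense. -/

namespace ErgodicExt

/-! ## Spectral measures of unitary operators -/

section Unitary

variable {H : Type*} [NormedAddCommGroup H] [InnerProductSpace ℂ H]

/-- The spectral measure of a vector `v` with respect to a unitary operator `U`. -/
def SpecMeas (U : H ≃ₗᵢ[ℂ] H) (v : H) (σ : Measure UnitAddCircle) : Prop :=
  IsFiniteMeasure σ ∧ ∀ s : ℤ, ∫ t, fourier s t ∂σ = inner ℂ v ((U ^ s) v)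

/-- The trigonometric polynomial with coefficients `c`. -/
noncomputable def trigPoly : (ℤ →₀ ℂ) →ₗ[ℂ] C(UnitAddCircle, ℂ) :=
  Finsupp.linearCombination ℂ (fun k : ℤ => (fourier k : C(UnitAddCircle, ℂ)))

/-- The value at `v` of the trigonometric polynomial with coefficients `c` in the operator `U`. -/
noncomputable def polyAt (U : H ≃ₗᵢ[ℂ] H) (v : H) : (ℤ →₀ ℂ) →ₗ[ℂ] H :=
  Finsupp.linearCombination ℂ (fun k : ℤ => (U ^ k) v)

theorem trigPoly_single (k : ℤ) (a : ℂ) (t : UnitAddCircle) :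
    trigPoly (Finsupp.single k a) t = a * fourier k t := by
  simp [trigPoly]

theorem polyAt_single (U : H ≃ₗᵢ[ℂ] H) (v : H) (k : ℤ) (a : ℂ) :
    polyAt U v (Finsupp.single k a) = a • (U ^ k) v := by
  simp [polyAt]

theorem polyAt_add_vector (U : H ≃ₗᵢ[ℂ] H) (v w : H) (c : ℤ →₀ ℂ) :
    polyAt U (v + w) c = polyAt U v c + polyAt U w c := by
  simp [polyAt, Finsupp.linearCombination_apply, Finsupp.sum, smul_add, Finset.sum_add_distrib]

theorem polyAt_smul_vector (U : H ≃ₗᵢ[ℂ] H) (a : ℂ) (v : H) (c : ℤ →₀ ℂ) :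
    polyAt U (a • v) c = a • polyAt U v c := by
  simp [polyAt, Finsupp.linearCombination_apply, Finsupp.sum, Finset.smul_sum, smul_comm a]

theorem continuous_integrable {σ : Measure UnitAddCircle} [IsFiniteMeasure σ]
    {E : Type*} [NormedAddCommGroup E] {f : UnitAddCircle → E} (hf : Continuous f) :
    Integrable f σ :=
  hf.integrable_of_hasCompactSupport (HasCompactSupport.of_compactSpace f)

theorem inner_zpow_apply (U : H ≃ₗᵢ[ℂ] H) (v : H) (j k : ℤ) :
    inner ℂ ((U ^ j) v) ((U ^ k) v) = inner ℂ v ((U ^ (k - j)) v) := by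
  have h : (U ^ k) v = (U ^ j) ((U ^ (k - j)) v) := by
    conv_lhs => rw [← add_sub_cancel j k, zpow_add]
    rfl
  rw [h, LinearIsometryEquiv.inner_map_map]

/-- Both sides are sesquilinear in `(c, d)`, and on monomials the identity is the definition of σ at
exponent `k - j`. Thus p ↦ p(U)v is isometric for the L²(σ) norm. -/
theorem SpecMeas.inner_polyAt {U : H ≃ₗᵢ[ℂ] H} {v : H} {σ : Measure UnitAddCircle}
    (h : SpecMeas U v σ) (c d : ℤ →₀ ℂ) :
    inner ℂ (polyAt U v c) (polyAt U v d) =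
      ∫ t, (starRingEnd ℂ) (trigPoly c t) * trigPoly d t ∂σ := by
  have := h.1
  induction c using Finsupp.induction_linear with
  | zero => simp
  | add c c' hc hc' =>
    rw [map_add, inner_add_left, hc, hc', ← integral_add]
    · simp [add_mul]
    all_goals exact continuous_integrable (by fun_prop)
  | single j a =>
    induction d using Finsupp.induction_linear with
    | zero => simp
    | add d d' hd hd' =>
      rw [map_add, inner_add_right, hd, hd', ← integral_add]
      · simp [mul_add]
      all_goals exact continuous_integrable (by fun_prop)
    | single k b =>
      simp only [polyAt_single, trigPoly_single, inner_smul_left, inner_smul_right,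
        inner_zpow_apply, ← h.2]
      rw [← integral_const_mul, ← integral_const_mul]
      congr 1
      ext t
      rw [sub_eq_add_neg, add_comm, fourier_add, fourier_neg, map_mul]
      ring

theorem SpecMeas.norm_sq_polyAt {U : H ≃ₗᵢ[ℂ] H} {v : H} {σ : Measure UnitAddCircle}
    (h : SpecMeas U v σ) (c : ℤ →₀ ℂ) :
    ‖polyAt U v c‖ ^ 2 = ∫ t, ‖trigPoly c t‖ ^ 2 ∂σ := by
  have h1 := h.inner_polyAt c c
  rw [inner_self_eq_norm_sq_to_K] at h1
  have h2 : ∀ t, (starRingEnd ℂ) (trigPoly c t) * trigPoly c t =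
      ((‖trigPoly c t‖ ^ 2 : ℝ) : ℂ) := by
    intro t
    rw [Complex.conj_mul']; push_cast; rfl
  simp_rw [h2] at h1
  rw [integral_complex_ofReal] at h1
  exact Complex.ofReal_injective ((Complex.ofReal_pow _ _).trans h1)

theorem polyAt_one (U : H ≃ₗᵢ[ℂ] H) (v : H) : polyAt U v (Finsupp.single 0 1) = v := by
  simp [polyAt_single]

theorem trigPoly_one (t : UnitAddCircle) : trigPoly (Finsupp.single 0 1) t = 1 := by
  simp [trigPoly_single]

theorem SpecMeas.norm_sq_sub_polyAt {U : H ≃ₗᵢ[ℂ] H} {v : H} {σ : Measure UnitAddCircle}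
    (h : SpecMeas U v σ) (c : ℤ →₀ ℂ) :
    ‖v - polyAt U v c‖ ^ 2 = ∫ t, ‖1 - trigPoly c t‖ ^ 2 ∂σ := by
  have := h.norm_sq_polyAt (Finsupp.single 0 1 - c)
  simpa only [map_sub, polyAt_one, ContinuousMap.sub_apply, trigPoly_one] using this

theorem SpecMeas.norm_polyAt_le {U : H ≃ₗᵢ[ℂ] H} {v : H} {σ : Measure UnitAddCircle}
    (h : SpecMeas U v σ) {c : ℤ →₀ ℂ} {C : ℝ} (hC : 0 ≤ C) (hc : ∀ t, ‖trigPoly c t‖ ≤ C) :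
    ‖polyAt U v c‖ ≤ C * ‖v‖ := by
  have := h.1
  have h1 := h.norm_sq_polyAt c
  have h2 := h.norm_sq_polyAt (Finsupp.single 0 1)
  simp only [polyAt_one, trigPoly_one] at h2
  refine abs_le_of_sq_le_sq' ?_ (by positivity) |>.2
  rw [h1, mul_pow, h2, ← integral_const_mul]
  refine integral_mono (continuous_integrable (by fun_prop)) (continuous_integrable (by fun_prop)) ?_
  intro t
  have := hc t
  simp only [norm_one, one_pow, mul_one]
  gcongr

variable [CompleteSpace H]

/-- The map from the spectrum of a unitary operator to the circle `ℝ/ℤ`. -/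
noncomputable def spectrumToCircle (u : unitary (H →L[ℂ] H)) :
    C(spectrum ℂ (u : H →L[ℂ] H), UnitAddCircle) where
  toFun x := (AddCircle.homeomorphCircle one_ne_zero).symm
    (⟨x.1, Unitary.spectrum_subset_circle u x.2⟩ : Circle)
  continuous_toFun := (AddCircle.homeomorphCircle one_ne_zero).symm.continuous.comp
    (continuous_subtype_val.subtype_mk _)

/-- The continuous functional calculus of a unitary operator, as a representation of the algebra
of continuous functions on `ℝ/ℤ`. -/
noncomputable def circleCalculus (u : unitary (H →L[ℂ] H)) :
    C(UnitAddCircle, ℂ) →⋆ₐ[ℂ] (H →L[ℂ] H) :=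
  (cfcHom (R := ℂ) (a := (u : H →L[ℂ] H)) (p := IsStarNormal) inferInstance).comp
    (ContinuousMap.compStarAlgHom' ℂ ℂ (spectrumToCircle u))

theorem circleCalculus_fourier_one (u : unitary (H →L[ℂ] H)) :
    circleCalculus u (fourier 1) = (u : H →L[ℂ] H) := by
  have h : (ContinuousMap.compStarAlgHom' ℂ ℂ (spectrumToCircle u)) (fourier 1) =
      ContinuousMap.restrict (spectrum ℂ (u : H →L[ℂ] H)) (ContinuousMap.id ℂ) := by
    ext x
    simp only [ContinuousMap.compStarAlgHom'_apply, ContinuousMap.comp_apply, fourier_one,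
      spectrumToCircle, ContinuousMap.coe_mk, ContinuousMap.restrict_apply, ContinuousMap.id_apply]
    rw [← AddCircle.homeomorphCircle_apply one_ne_zero]
    exact congrArg Subtype.val (Homeomorph.apply_symm_apply (AddCircle.homeomorphCircle one_ne_zero)
      (⟨x.1, Unitary.spectrum_subset_circle u x.2⟩ : Circle))
  rw [circleCalculus, StarAlgHom.comp_apply, h, cfcHom_id]

theorem circleCalculus_fourier (u : unitary (H →L[ℂ] H)) (s : ℤ) :
    circleCalculus u (fourier s) = ((u ^ s : unitary (H →L[ℂ] H)) : H →L[ℂ] H) := by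
  have hstep : ∀ s : ℤ, circleCalculus u (fourier (s + 1)) =
      circleCalculus u (fourier s) * (u : H →L[ℂ] H) := by
    intro s
    rw [← circleCalculus_fourier_one, ← map_mul]
    congr 1
    ext t
    exact fourier_add
  induction s using Int.induction_on with
  | zero =>
    have : (fourier 0 : C(UnitAddCircle, ℂ)) = 1 := by ext; simp
    rw [this, map_one]; simp
  | succ n ih => rw [hstep, ih, zpow_add_one]; rfl
  | pred n ih =>
    have h := hstep (-(n : ℤ) - 1)
    rw [sub_add_cancel, ih] at h
    rw [zpow_sub_one]
    have h2 := congrArg (· * ((u⁻¹ : unitary (H →L[ℂ] H)) : H →L[ℂ] H)) h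
    simp only [mul_assoc] at h2
    have h3 : (u : H →L[ℂ] H) * ((u⁻¹ : unitary (H →L[ℂ] H)) : H →L[ℂ] H) = 1 := by
      rw [← Submonoid.coe_mul, mul_inv_cancel]; rfl
    rw [h3, mul_one] at h2
    rw [← h2]; rfl

/-- The complex function attached to a real continuous function. -/
def complexify (f : CompactlySupportedContinuousMap UnitAddCircle ℝ) : C(UnitAddCircle, ℂ) :=
  ⟨fun t => (f t : ℂ), by fun_prop⟩

/-- The positive functional `f ↦ ⟪v, f(U) v⟫` on real continuous functions. -/
noncomputable def spectralFunctional (u : unitary (H →L[ℂ] H)) (v : H) :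
    CompactlySupportedContinuousMap UnitAddCircle ℝ →ₚ[ℝ] ℝ :=
  PositiveLinearMap.mk₀
    { toFun f := (inner ℂ v (circleCalculus u (complexify f) v)).re
      map_add' f g := by
        have : complexify (f + g) = complexify f + complexify g := by ext; simp [complexify]
        simp [this]
      map_smul' a f := by
        have : complexify (a • f) = (a : ℂ) • complexify f := by ext; simp [complexify]
        rw [this, map_smul, smul_apply, inner_smul_right]
        simp }
    (by
      intro f hf
      -- With g = √f the value of the functional is ‖g(U)v‖², hence nonnegative.
      let g : C(UnitAddCircle, ℂ) := ⟨fun t => ((√(f t) : ℝ) : ℂ), by fun_prop⟩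
      have hg : complexify f = star g * g := by
        ext t
        simp only [complexify, ContinuousMap.coe_mk, ContinuousMap.mul_apply,
          ContinuousMap.star_apply, g, RCLike.star_def, Complex.conj_ofReal]
        rw [← Complex.ofReal_mul, Real.mul_self_sqrt (hf t)]
      change 0 ≤ (inner ℂ v (circleCalculus u (complexify f) v)).re
      rw [hg, map_mul, map_star, mul_apply_eq_comp, ContinuousLinearMap.star_eq_adjoint,
        ContinuousLinearMap.adjoint_inner_right]
      exact inner_self_nonneg (𝕜 := ℂ))

theorem inner_circleCalculus_im (u : unitary (H →L[ℂ] H)) (v : H)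
    (f : CompactlySupportedContinuousMap UnitAddCircle ℝ) :
    (inner ℂ v (circleCalculus u (complexify f) v)).im = 0 := by
  have hs : star (complexify f) = complexify f := by
    ext t; simp [complexify]
  have h : (starRingEnd ℂ) (inner ℂ v (circleCalculus u (complexify f) v)) =
      inner ℂ v (circleCalculus u (complexify f) v) := by
    rw [inner_conj_symm, ← ContinuousLinearMap.adjoint_inner_right,
      ← ContinuousLinearMap.star_eq_adjoint, ← map_star, hs]
  exact Complex.conj_eq_iff_im.1 h

/-- **Herglotz theorem** for unitary operators: spectral measures exist. -/
theorem exists_specMeas (U : H ≃ₗᵢ[ℂ] H) (v : H) : ∃ σ, SpecMeas U v σ := by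
  let u : unitary (H →L[ℂ] H) := Unitary.linearIsometryEquiv.symm U
  have hu : ∀ (s : ℤ) (w : H), ((u ^ s : unitary (H →L[ℂ] H)) : H →L[ℂ] H) w = (U ^ s) w := by
    intro s w
    have : U ^ s = Unitary.linearIsometryEquiv (u ^ s) := by
      rw [map_zpow, MulEquiv.apply_symm_apply]
    rw [this]; rfl
  refine ⟨RealRMK.rieszMeasure (spectralFunctional u v), ?_, fun s => ?_⟩
  · refine ⟨?_⟩
    exact isCompact_univ.measure_lt_top
  · let R : CompactlySupportedContinuousMap UnitAddCircle ℝ :=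
      CompactlySupportedContinuousMap.continuousMapEquiv ⟨fun t => (fourier s t).re, by fun_prop⟩
    let I : CompactlySupportedContinuousMap UnitAddCircle ℝ :=
      CompactlySupportedContinuousMap.continuousMapEquiv ⟨fun t => (fourier s t).im, by fun_prop⟩
    -- The Riesz measure represents a functional on real functions, so the character is split into
    -- real and imaginary parts.
    have hRI : (fourier s : C(UnitAddCircle, ℂ)) = complexify R + Complex.I • complexify I := by
      ext t
      change fourier s t = ((fourier s t).re : ℂ) + Complex.I * ((fourier s t).im : ℂ)
      rw [mul_comm, Complex.re_add_im]
    have : IsFiniteMeasure (RealRMK.rieszMeasure (spectralFunctional u v)) :=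
      ⟨isCompact_univ.measure_lt_top⟩
    have hf : ∀ f : CompactlySupportedContinuousMap UnitAddCircle ℝ,
        ((∫ t, f t ∂(RealRMK.rieszMeasure (spectralFunctional u v)) : ℝ) : ℂ) =
          inner ℂ v (circleCalculus u (complexify f) v) := by
      intro f
      rw [RealRMK.integral_rieszMeasure]
      apply Complex.ext
      · rfl
      · rw [inner_circleCalculus_im]; simp
    have h1 : ∀ t, fourier s t = ((R t : ℝ) : ℂ) + Complex.I * ((I t : ℝ) : ℂ) := fun t =>
      DFunLike.congr_fun hRI t
    simp_rw [h1]
    rw [integral_add (continuous_integrable (by fun_prop)) (continuous_integrable (by fun_prop)),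
      integral_const_mul, integral_complex_ofReal, integral_complex_ofReal, hf, hf, ← hu,
      ← circleCalculus_fourier, hRI]
    simp

end Unitary

/-! ## A criterion for singularity -/

/-- The trigonometric polynomial `c` is bounded by `2` and small in `L²` of the circle. -/
def GoodPoly (ε : ℝ) (c : ℤ →₀ ℂ) : Prop :=
  ∫ t, ‖trigPoly c t‖ ^ 2 ∂(volume : Measure UnitAddCircle) < ε ∧ ∀ t, ‖trigPoly c t‖ ≤ 2

theorem exists_trigPoly_near (g : C(UnitAddCircle, ℂ)) {η : ℝ} (hη : 0 < η) :
    ∃ c : ℤ →₀ ℂ, ∀ t, ‖trigPoly c t - g t‖ < η := by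
  have h : g ∈ closure (Submodule.span ℂ (range (fourier (T := 1))) : Set C(UnitAddCircle, ℂ)) := by
    rw [← Submodule.topologicalClosure_coe, span_fourier_closure_eq_top]
    trivial
  obtain ⟨p, hp, hd⟩ := Metric.mem_closure_iff.1 h η hη
  rw [SetLike.mem_coe, ← Finsupp.range_linearCombination] at hp
  obtain ⟨c, rfl⟩ := hp
  refine ⟨c, fun t => ?_⟩
  rw [dist_comm, dist_eq_norm] at hd
  exact (ContinuousMap.norm_coe_le_norm _ t).trans_lt hd

/-- Inner regularity gives a closed Lebesgue-null set K carrying all of σ up to δ; outer regularity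
gives an open U ⊇ K of Lebesgue measure below δ. A Urysohn function equal to 1 on K and 0 off U
works. -/
theorem exists_continuous_separating {σ : Measure UnitAddCircle} [IsFiniteMeasure σ]
    (h : σ ⟂ₘ (volume : Measure UnitAddCircle)) {δ : ℝ} (hδ : 0 < δ) :
    ∃ g : C(UnitAddCircle, ℝ), (∀ t, g t ∈ Icc (0 : ℝ) 1) ∧
      ∫ t, g t ∂(volume : Measure UnitAddCircle) ≤ δ ∧ ∫ t, (1 - g t) ∂σ ≤ δ := by
  have hδ' : ENNReal.ofReal δ ≠ 0 := by simpa using hδ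
  obtain ⟨K, hKN, hK, hKσ⟩ := h.measurableSet_nullSet.compl.exists_isClosed_sdiff_lt
    (measure_ne_top σ _) hδ'
  have hK0 : (volume : Measure UnitAddCircle) K = 0 :=
    measure_mono_null hKN h.measure_compl_nullSet
  obtain ⟨U, hKU, hU, hUv⟩ := K.exists_isOpen_lt_of_lt (μ := (volume : Measure UnitAddCircle))
    (ENNReal.ofReal δ) (by rw [hK0]; exact pos_iff_ne_zero.2 hδ')
  obtain ⟨g, hg0, hg1, hg⟩ := exists_continuous_zero_one_of_isClosed hU.isClosed_compl hK
    (disjoint_left.2 fun x hx hxK => hx (hKU hxK))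
  have hKc : σ Kᶜ ≤ ENNReal.ofReal δ := by
    have : Kᶜ ⊆ h.nullSet ∪ (h.nullSetᶜ \ K) := by
      intro x hx
      by_cases hN : x ∈ h.nullSet
      · exact Or.inl hN
      · exact Or.inr ⟨hN, hx⟩
    calc σ Kᶜ ≤ σ h.nullSet + σ (h.nullSetᶜ \ K) := (measure_mono this).trans (measure_union_le _ _)
      _ ≤ _ := by rw [h.measure_nullSet, zero_add]; exact hKσ.le
  refine ⟨g, hg, ?_, ?_⟩
  · calc ∫ t, g t ∂(volume : Measure UnitAddCircle)
        ≤ ∫ t, U.indicator 1 t ∂(volume : Measure UnitAddCircle) := by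
          refine integral_mono (continuous_integrable g.continuous)
            ((integrable_const 1).indicator hU.measurableSet) fun t => ?_
          by_cases ht : t ∈ U
          · simpa [ht] using (hg t).2
          · simpa [ht] using (hg0 ht).le
      _ = (volume : Measure UnitAddCircle).real U := integral_indicator_one hU.measurableSet
      _ ≤ δ := ENNReal.toReal_le_of_le_ofReal hδ.le hUv.le
  · calc ∫ t, (1 - g t) ∂σ
        ≤ ∫ t, Kᶜ.indicator 1 t ∂σ := by
          refine integral_mono (continuous_integrable (by fun_prop))
            ((integrable_const 1).indicator hK.measurableSet.compl) fun t => ?_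
          by_cases ht : t ∈ K
          · simpa [ht] using (hg1 ht).ge
          · simpa [ht] using (hg t).1
      _ = σ.real Kᶜ := integral_indicator_one hK.measurableSet.compl
      _ ≤ δ := ENNReal.toReal_le_of_le_ofReal hδ.le hKc

theorem exists_goodPoly {σ : Measure UnitAddCircle} [IsFiniteMeasure σ]
    (h : σ ⟂ₘ (volume : Measure UnitAddCircle)) {ε : ℝ} (hε : 0 < ε) :
    ∃ c, GoodPoly ε c ∧ ∫ t, ‖1 - trigPoly c t‖ ^ 2 ∂σ < ε := by
  obtain ⟨g, hg, hgv, hgσ⟩ := exists_continuous_separating h (δ := ε / 8) (by positivity)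
  have hM : 0 ≤ σ.real univ := measureReal_nonneg
  -- η ≤ 1 yields the bound 1 + η ≤ 2 on the polynomial; the other term makes both η and η σ(T) at
  -- most ε / 8, so each final integral is at most ε / 2.
  set η : ℝ := min 1 (ε / (8 * (1 + σ.real univ))) with hη
  have hη0 : 0 < η := by positivity
  have hη1 : η ≤ 1 := min_le_left _ _
  have hηε : η * (1 + σ.real univ) ≤ ε / 8 := by
    have : η ≤ ε / (8 * (1 + σ.real univ)) := min_le_right _ _
    rw [le_div_iff₀ (by positivity)] at this
    linarith
  have hηη : η ^ 2 ≤ η := by nlinarith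
  have hηM : 0 ≤ η * σ.real univ := by positivity
  obtain ⟨c, hc⟩ := exists_trigPoly_near ⟨fun t => (g t : ℂ), by fun_prop⟩ hη0
  have hc' : ∀ t, ‖trigPoly c t - (g t : ℂ)‖ < η := hc
  have h1 : ∀ t, ‖trigPoly c t‖ ≤ g t + η := by
    intro t
    have := norm_add_le (trigPoly c t - (g t : ℂ)) (g t : ℂ)
    rw [sub_add_cancel, Complex.norm_of_nonneg (hg t).1] at this
    linarith [hc' t]
  have h2 : ∀ t, ‖1 - trigPoly c t‖ ≤ (1 - g t) + η := by
    intro t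
    have := norm_add_le ((g t : ℂ) - trigPoly c t) (((1 - g t : ℝ)) : ℂ)
    rw [Complex.norm_of_nonneg (by linarith [(hg t).2]), norm_sub_rev] at this
    have h3 : (g t : ℂ) - trigPoly c t + ((1 - g t : ℝ) : ℂ) = 1 - trigPoly c t := by
      push_cast; ring
    rw [h3] at this
    linarith [hc' t]
  have hsq : ∀ a b : ℝ, 0 ≤ a → a ≤ 1 → 0 ≤ b → b ≤ a + η → b ^ 2 ≤ 2 * a + 2 * η := by
    intro a b ha ha1 hb hab
    nlinarith [sq_nonneg (a - η)]
  refine ⟨c, ⟨?_, fun t => (h1 t).trans (by linarith [(hg t).2])⟩, ?_⟩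
  · calc ∫ t, ‖trigPoly c t‖ ^ 2 ∂(volume : Measure UnitAddCircle)
        ≤ ∫ t, (2 * g t + 2 * η) ∂(volume : Measure UnitAddCircle) :=
          integral_mono (continuous_integrable (by fun_prop)) (continuous_integrable (by fun_prop))
            fun t => hsq _ _ (hg t).1 (hg t).2 (norm_nonneg _) (h1 t)
      _ = 2 * (∫ t, g t ∂(volume : Measure UnitAddCircle)) + 2 * η := by
          rw [integral_add (continuous_integrable (by fun_prop)) (integrable_const _),
            integral_const_mul]
          simp [Measure.real]
      _ < ε := by nlinarith
  · calc ∫ t, ‖1 - trigPoly c t‖ ^ 2 ∂σ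
        ≤ ∫ t, (2 * (1 - g t) + 2 * η) ∂σ :=
          integral_mono (continuous_integrable (by fun_prop)) (continuous_integrable (by fun_prop))
            fun t => hsq _ _ (by linarith [(hg t).2]) (by linarith [(hg t).1]) (norm_nonneg _) (h2 t)
      _ = 2 * (∫ t, (1 - g t) ∂σ) + 2 * (η * σ.real univ) := by
          rw [integral_add (continuous_integrable (by fun_prop)) (integrable_const _),
            integral_const_mul, integral_const, smul_eq_mul]
          ring
      _ < ε := by nlinarith

/-- The sum of the ‖f n‖² has finite integral, so it converges almost everywhere and its terms tend
to 0. -/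
theorem ae_tendsto_zero_of_integral_sq_lt {σ : Measure UnitAddCircle} [IsFiniteMeasure σ]
    (f : ℕ → C(UnitAddCircle, ℂ)) (hf : ∀ n, ∫ t, ‖f n t‖ ^ 2 ∂σ ≤ (1 / 2) ^ n) :
    ∀ᵐ t ∂σ, Tendsto (fun n => f n t) atTop (𝓝 0) := by
  have h1 : ∀ n, ∫⁻ t, ENNReal.ofReal (‖f n t‖ ^ 2) ∂σ ≤ ENNReal.ofReal ((1 / 2) ^ n) := by
    intro n
    rw [← ofReal_integral_eq_lintegral_ofReal (continuous_integrable (by fun_prop))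
      (Eventually.of_forall fun t => by positivity)]
    exact ENNReal.ofReal_le_ofReal (hf n)
  have h2 : ∫⁻ t, ∑' n, ENNReal.ofReal (‖f n t‖ ^ 2) ∂σ ≠ ⊤ := by
    rw [lintegral_tsum fun n => by fun_prop]
    refine ne_top_of_le_ne_top ?_ (ENNReal.tsum_le_tsum h1)
    rw [← ENNReal.ofReal_tsum_of_nonneg (fun n => by positivity) summable_geometric_two]
    exact ENNReal.ofReal_ne_top
  filter_upwards [ae_lt_top' (AEMeasurable.tsum fun n => by fun_prop) h2] with t ht
  have h3 := ENNReal.tendsto_atTop_zero_of_tsum_ne_top ht.ne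
  have h4 : Tendsto (fun n => ‖f n t‖ ^ 2) atTop (𝓝 0) := by
    have := (ENNReal.tendsto_toReal ENNReal.zero_ne_top).comp h3
    simpa [Function.comp_def] using this
  have h5 : Tendsto (fun n => ‖f n t‖) atTop (𝓝 0) := by
    have := (Real.continuous_sqrt.tendsto 0).comp h4
    simpa [Function.comp_def, Real.sqrt_sq] using this
  exact tendsto_zero_iff_norm_tendsto_zero.2 h5

theorem mutuallySingular_of_poly {σ : Measure UnitAddCircle} [IsFiniteMeasure σ]
    (h : ∀ ε > 0, ∃ c, GoodPoly ε c ∧ ∫ t, ‖1 - trigPoly c t‖ ^ 2 ∂σ < ε) :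
    σ ⟂ₘ (volume : Measure UnitAddCircle) := by
  choose c hc using fun n : ℕ => h ((1 / 2) ^ n) (by positivity)
  have h1 := ae_tendsto_zero_of_integral_sq_lt (σ := (volume : Measure UnitAddCircle))
    (fun n => trigPoly (c n)) fun n => (hc n).1.1.le
  have h2 := ae_tendsto_zero_of_integral_sq_lt (σ := σ)
    (fun n => 1 - trigPoly (c n)) fun n => (hc n).2.le
  refine Measure.MutuallySingular.mk (ae_iff.1 h2) (ae_iff.1 h1) fun t _ => ?_
  by_contra hcon
  simp only [mem_union, mem_ofPred_eq, not_or, not_not] at hcon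
  have h3 := hcon.1.add hcon.2
  simp only [ContinuousMap.sub_apply, ContinuousMap.one_apply, sub_add_cancel, add_zero] at h3
  exact one_ne_zero (tendsto_nhds_unique tendsto_const_nhds h3)

/-! ### The closed subspace of vectors with singular spectral measure -/

section Singular

variable {H : Type*} [NormedAddCommGroup H] [InnerProductSpace ℂ H]

/-- The vector `v` has a singular spectral measure. -/
def SingVec (U : H ≃ₗᵢ[ℂ] H) (v : H) : Prop :=
  ∃ σ, SpecMeas U v σ ∧ σ ⟂ₘ (volume : Measure UnitAddCircle)

/-- The sum of the two spectral measures is still singular, and a polynomial that is good for the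
sum is good for both vectors at once. This is what makes singular vectors closed under addition. -/
theorem SingVec.exists_poly₂ {U : H ≃ₗᵢ[ℂ] H} {v w : H} (hv : SingVec U v) (hw : SingVec U w)
    {ε : ℝ} (hε : 0 < ε) :
    ∃ c, GoodPoly ε c ∧ ‖v - polyAt U v c‖ < ε ∧ ‖w - polyAt U w c‖ < ε := by
  obtain ⟨σ, hσ, hσs⟩ := hv
  obtain ⟨τ, hτ, hτs⟩ := hw
  have := hσ.1
  have := hτ.1
  -- ε² appears because the integrals control squared norms.
  have hpos : 0 < min ε (ε ^ 2) := by positivity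
  obtain ⟨c, hc, hc2⟩ := exists_goodPoly (hσs.add_left hτs) hpos
  rw [integral_add_measure (continuous_integrable (by fun_prop))
    (continuous_integrable (by fun_prop)), ← hσ.norm_sq_sub_polyAt, ← hτ.norm_sq_sub_polyAt] at hc2
  have h2 := hc2.trans_le (min_le_right _ _)
  refine ⟨c, ⟨hc.1.trans_le (min_le_left _ _), hc.2⟩, ?_, ?_⟩
  · exact lt_of_pow_lt_pow_left₀ 2 hε.le (by nlinarith [sq_nonneg ‖w - polyAt U w c‖])
  · exact lt_of_pow_lt_pow_left₀ 2 hε.le (by nlinarith [sq_nonneg ‖v - polyAt U v c‖])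

theorem singVec_zero (U : H ≃ₗᵢ[ℂ] H) : SingVec U 0 :=
  ⟨0, ⟨inferInstance, by simp⟩, Measure.MutuallySingular.zero_left⟩

variable [CompleteSpace H]

/-- This replaces the measure by a condition on finitely many powers of U applied to v, which is
stable under perturbation of U and of v. -/
theorem singVec_iff {U : H ≃ₗᵢ[ℂ] H} {v : H} :
    SingVec U v ↔ ∀ ε > 0, ∃ c, GoodPoly ε c ∧ ‖v - polyAt U v c‖ < ε := by
  constructor
  · intro h ε hε
    obtain ⟨c, hc, h1, -⟩ := h.exists_poly₂ h hε
    exact ⟨c, hc, h1⟩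
  · intro h
    obtain ⟨σ, hσ⟩ := exists_specMeas U v
    have := hσ.1
    refine ⟨σ, hσ, mutuallySingular_of_poly fun ε hε => ?_⟩
    obtain ⟨c, hc, h1⟩ := h (min 1 ε) (by positivity)
    refine ⟨c, ⟨hc.1.trans_le (min_le_right _ _), hc.2⟩, ?_⟩
    rw [← hσ.norm_sq_sub_polyAt]
    have h2 := h1.trans_le (min_le_left _ _)
    have h3 := h1.trans_le (min_le_right _ _)
    nlinarith [norm_nonneg (v - polyAt U v c)]

/-- The sup bound in `GoodPoly` becomes an operator bound independent of the polynomial and of U;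
the passage to limits of vectors rests on it. -/
theorem norm_polyAt_le (U : H ≃ₗᵢ[ℂ] H) {ε : ℝ} {c : ℤ →₀ ℂ} (hc : GoodPoly ε c) (v : H) :
    ‖polyAt U v c‖ ≤ 2 * ‖v‖ := by
  obtain ⟨σ, hσ⟩ := exists_specMeas U v
  exact hσ.norm_polyAt_le zero_le_two hc.2

theorem SingVec.add {U : H ≃ₗᵢ[ℂ] H} {v w : H} (hv : SingVec U v) (hw : SingVec U w) :
    SingVec U (v + w) := by
  refine singVec_iff.2 fun ε hε => ?_
  obtain ⟨c, hc, h1, h2⟩ := hv.exists_poly₂ hw (half_pos hε)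
  refine ⟨c, ⟨hc.1.trans (half_lt_self hε), hc.2⟩, ?_⟩
  rw [polyAt_add_vector, add_sub_add_comm]
  exact (norm_add_le _ _).trans_lt (by linarith)

theorem SingVec.smul {U : H ≃ₗᵢ[ℂ] H} {v : H} (hv : SingVec U v) (a : ℂ) :
    SingVec U (a • v) := by
  refine singVec_iff.2 fun ε hε => ?_
  obtain ⟨c, hc, h1⟩ := singVec_iff.1 hv (min ε (ε / (‖a‖ + 1))) (by positivity)
  refine ⟨c, ⟨hc.1.trans_le (min_le_left _ _), hc.2⟩, ?_⟩
  rw [polyAt_smul_vector, ← smul_sub, norm_smul]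
  have h2 := h1.trans_le (min_le_right _ _)
  rw [lt_div_iff₀ (by positivity)] at h2
  nlinarith [norm_nonneg (v - polyAt U v c)]

theorem singVec_of_closure {U : H ≃ₗᵢ[ℂ] H} {v : H}
    (h : ∀ ε > 0, ∃ w, SingVec U w ∧ ‖v - w‖ < ε) : SingVec U v := by
  refine singVec_iff.2 fun ε hε => ?_
  -- The error is ‖v - w‖ + ‖w - p(U)w‖ + ‖p(U)(v - w)‖, where the last term is at most 2‖v - w‖:
  -- quarters of ε suffice.
  obtain ⟨w, hw, hvw⟩ := h (ε / 4) (by positivity)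
  obtain ⟨c, hc, h1⟩ := singVec_iff.1 hw (ε / 4) (by positivity)
  refine ⟨c, ⟨hc.1.trans (by linarith), hc.2⟩, ?_⟩
  have h2 : v - polyAt U v c = (v - w) + (w - polyAt U w c) - polyAt U (v - w) c := by
    have := polyAt_add_vector U (v - w) w c
    rw [sub_add_cancel] at this
    rw [this]; abel
  rw [h2]
  have h3 := norm_sub_le ((v - w) + (w - polyAt U w c)) (polyAt U (v - w) c)
  have h4 := norm_add_le (v - w) (w - polyAt U w c)
  have h5 := norm_polyAt_le U hc (v - w)
  linarith

/-- The subspace of vectors with singular spectral measure. -/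
def singSubmodule (U : H ≃ₗᵢ[ℂ] H) : Submodule ℂ H where
  carrier := {v | SingVec U v}
  add_mem' hv hw := SingVec.add hv hw
  zero_mem' := singVec_zero U
  smul_mem' a _ hv := SingVec.smul hv a

theorem isClosed_singSubmodule (U : H ≃ₗᵢ[ℂ] H) : IsClosed (singSubmodule U : Set H) := by
  refine isClosed_of_closure_subset fun v hv => singVec_of_closure fun ε hε => ?_
  obtain ⟨w, hw, hd⟩ := Metric.mem_closure_iff.1 hv ε hε
  exact ⟨w, hw, by rwa [← dist_eq_norm]⟩

theorem volume_singleton_unitAddCircle (t : UnitAddCircle) :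
    (volume : Measure UnitAddCircle) {t} = 0 := by
  refine le_antisymm (ENNReal.le_of_forall_pos_le_add fun ε hε _ => ?_) bot_le
  have h : (volume : Measure UnitAddCircle) (Metric.closedBall t (ε / 2)) ≤ ε := by
    rw [AddCircle.volume_closedBall]
    calc _ ≤ ENNReal.ofReal (2 * (ε / 2)) := ENNReal.ofReal_le_ofReal (min_le_right _ _)
      _ = ε := by rw [mul_div_cancel₀ _ two_ne_zero]; exact ENNReal.ofReal_coe_nnreal
  rw [zero_add]
  exact (measure_mono (singleton_subset_iff.2
    (Metric.mem_closedBall_self (by positivity)))).trans h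

/-- Vectors fixed by a nonzero power have singular spectral measure. -/
theorem singVec_of_pow_fixed {U : H ≃ₗᵢ[ℂ] H} {v : H} {q : ℕ} (hq : 0 < q)
    (h : (U ^ (q : ℤ)) v = v) : SingVec U v := by
  obtain ⟨σ, hσ⟩ := exists_specMeas U v
  have := hσ.1
  refine ⟨σ, hσ, ?_⟩
  -- For p = z^q this reads ∫|1 - z^q|² dσ = 0, so σ is carried by the finitely many q-th roots of
  -- unity.
  have h1 := hσ.norm_sq_sub_polyAt (Finsupp.single (q : ℤ) 1)
  rw [polyAt_single, h, one_smul, sub_self, norm_zero, zero_pow two_ne_zero, eq_comm,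
    integral_eq_zero_iff_of_nonneg (fun t => by positivity)
      (continuous_integrable (by fun_prop))] at h1
  have hfin : {t : UnitAddCircle | q • t = 0}.Finite := AddCircle.finite_torsion 1 hq
  have hvol : (volume : Measure UnitAddCircle) {t : UnitAddCircle | q • t = 0} = 0 := by
    rw [← biUnion_of_singleton {t : UnitAddCircle | q • t = 0},
      measure_biUnion_null_iff hfin.countable]
    exact fun t _ => volume_singleton_unitAddCircle t
  have hσ0 : σ {t : UnitAddCircle | q • t = 0}ᶜ = 0 := by
    refine measure_mono_null ?_ (ae_iff.1 h1)
    intro t ht h2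
    apply ht
    simp only [trigPoly_single, one_mul, Pi.zero_apply, sq_eq_zero_iff, norm_eq_zero,
      sub_eq_zero] at h2
    rw [fourier_apply, natCast_zsmul] at h2
    have h3 : (AddCircle.toCircle (q • t) : Circle) = 1 := Subtype.ext h2.symm
    rw [← AddCircle.toCircle_zero (T := 1)] at h3
    exact AddCircle.injective_toCircle one_ne_zero h3
  exact Measure.MutuallySingular.mk hσ0 hvol fun t _ => by
    by_cases ht : q • t = 0
    · exact Or.inr ht
    · exact Or.inl ht

end Singular

/-! ## Koopman operators -/

section Koopman

variable {Z : Type*} [MeasurableSpace Z] {ν : Measure Z}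

instance : MulAction (MPEquiv ν) Z where
  smul e z := e.1 z
  one_smul _ := rfl
  mul_smul _ _ _ := rfl

theorem measurable_smul_const (e : MPEquiv ν) : Measurable (fun z : Z => e • z) := e.1.measurable

theorem measurePreserving_smul_mp (e : MPEquiv ν) : MeasurePreserving (fun z : Z => e • z) ν ν :=
  e.2

theorem Aut.mk_mul (e f : MPEquiv ν) : Aut.mk (e * f) = Aut.mk e * Aut.mk f := rfl

theorem Aut.mk_one : Aut.mk (1 : MPEquiv ν) = 1 := rfl

theorem Aut.mk_inv (e : MPEquiv ν) : Aut.mk e⁻¹ = (Aut.mk e)⁻¹ := rfl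

/-- The quotient map as a group homomorphism. -/
def Aut.mkHom (ν : Measure Z) : MPEquiv ν →* Aut ν where
  toFun := Aut.mk
  map_one' := rfl
  map_mul' _ _ := rfl

theorem Aut.mk_zpow (e : MPEquiv ν) (s : ℤ) : Aut.mk (e ^ s) = Aut.mk e ^ s :=
  map_zpow (Aut.mkHom ν) e s

theorem Aut.exists_rep (R : Aut ν) : ∃ e, Aut.mk e = R := ⟨R.rep, R.mk_rep⟩

theorem koopman_mk_ae (e : MPEquiv ν) (f : Lp ℂ 2 ν) :
    koopman (Aut.mk e) f =ᵐ[ν] fun z => f (e • z) := by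
  have h1 : koopman (Aut.mk e) f =ᵐ[ν] f ∘ (Aut.mk e) :=
    Lp.coeFn_compMeasurePreserving f (Aut.mk e).measurePreserving
  filter_upwards [h1, Aut.rep_mk e] with z hz hz2
  rw [hz, Function.comp_apply, hz2]; rfl

theorem koopman_mul (R T : Aut ν) (f : Lp ℂ 2 ν) :
    koopman (R * T) f = koopman T (koopman R f) := by
  obtain ⟨e, rfl⟩ := R.exists_rep
  obtain ⟨e', rfl⟩ := T.exists_rep
  refine Lp.ext ?_
  rw [← Aut.mk_mul]
  filter_upwards [koopman_mk_ae (e * e') f, koopman_mk_ae e' (koopman (Aut.mk e) f),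
    e'.2.quasiMeasurePreserving.ae (koopman_mk_ae e f)] with z h1 h2 h3
  rw [h1, h2, mul_smul]
  exact h3.symm

theorem koopman_one (f : Lp ℂ 2 ν) : koopman (1 : Aut ν) f = f := by
  refine Lp.ext ?_
  rw [← Aut.mk_one]
  filter_upwards [koopman_mk_ae 1 f] with z h1
  rw [h1, one_smul]

/-- The unitary representation `R ↦ (f ↦ f ∘ R⁻¹)`. -/
noncomputable def koopmanHom (ν : Measure Z) : Aut ν →* (Lp ℂ 2 ν ≃ₗᵢ[ℂ] Lp ℂ 2 ν) where
  toFun R :=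
    { koopman R⁻¹ with
      invFun := koopman R
      left_inv := fun f => by
        change koopman R (koopman R⁻¹ f) = f
        rw [← koopman_mul, inv_mul_cancel, koopman_one]
      right_inv := fun f => by
        change koopman R⁻¹ (koopman R f) = f
        rw [← koopman_mul, mul_inv_cancel, koopman_one]
      norm_map' := (koopman R⁻¹).norm_map }
  map_one' := by
    ext1 f
    change koopman (1 : Aut ν)⁻¹ f = f
    rw [inv_one, koopman_one]
  map_mul' R T := by
    ext1 f
    change koopman (R * T)⁻¹ f = koopman R⁻¹ (koopman T⁻¹ f)
    rw [mul_inv_rev, koopman_mul]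

/-- The Koopman operator as a unitary operator. -/
noncomputable def koopmanUnitary (R : Aut ν) : Lp ℂ 2 ν ≃ₗᵢ[ℂ] Lp ℂ 2 ν := koopmanHom ν R⁻¹

theorem koopmanUnitary_apply (R : Aut ν) (f : Lp ℂ 2 ν) : koopmanUnitary R f = koopman R f := by
  change koopman R⁻¹⁻¹ f = _
  rw [inv_inv]

theorem koopmanUnitary_zpow_apply (R : Aut ν) (s : ℤ) (f : Lp ℂ 2 ν) :
    (koopmanUnitary R ^ s) f = koopman (R ^ s) f := by
  rw [koopmanUnitary, ← map_zpow, inv_zpow]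
  exact koopmanUnitary_apply _ f

theorem isSpectralMeasure_iff {R : Aut ν} {f : Lp ℂ 2 ν} {σ : Measure UnitAddCircle} :
    IsSpectralMeasure R f σ ↔ SpecMeas (koopmanUnitary R) f σ := by
  simp only [IsSpectralMeasure, SpecMeas, koopmanUnitary_zpow_apply]

theorem hasSingularSpectrum_iff {R : Aut ν} :
    HasSingularSpectrum R ↔ ∀ f, SingVec (koopmanUnitary R) f := by
  simp only [HasSingularSpectrum, SingVec, isSpectralMeasure_iff]

theorem singVec_koopman_iff {R : Aut ν} {f : Lp ℂ 2 ν} :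
    SingVec (koopmanUnitary R) f ↔
      ∃ σ, IsSpectralMeasure R f σ ∧ σ ⟂ₘ (volume : Measure UnitAddCircle) := by
  simp only [SingVec, isSpectralMeasure_iff]

/-- Singularity of the spectrum is invariant under conjugation. -/
theorem HasSingularSpectrum.conj {R : Aut ν} (h : HasSingularSpectrum R) (J : Aut ν) :
    HasSingularSpectrum (J⁻¹ * R * J) := by
  intro f
  -- The spectral measure of f under J⁻¹RJ is that of f ∘ J⁻¹ under R.
  obtain ⟨σ, ⟨hσ, hs⟩, hsing⟩ := h (koopman J⁻¹ f)
  refine ⟨σ, ⟨hσ, fun s => ?_⟩, hsing⟩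
  have hpow : (J⁻¹ * R * J) ^ s = J⁻¹ * R ^ s * J := by
    have := conj_zpow (i := s) (a := J⁻¹) (b := R)
    rwa [inv_inv] at this
  rw [hs, hpow, koopman_mul, koopman_mul, ← (koopman J).inner_map_map, ← koopman_mul J⁻¹ J,
    inv_mul_cancel, koopman_one]

variable [IsProbabilityMeasure ν]

/-- The indicator function of a measurable set, as an element of `L²`. -/
noncomputable def ind (ν : Measure Z) [IsProbabilityMeasure ν] {C : Set Z} (hC : MeasurableSet C) :
    Lp ℂ 2 ν :=
  indicatorConstLp 2 hC (measure_ne_top ν C) (1 : ℂ)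

theorem koopman_ind (e : MPEquiv ν) {C : Set Z} (hC : MeasurableSet C) :
    koopman (Aut.mk e) (ind ν hC) = ind ν (measurable_smul_const e hC) := by
  refine Lp.ext ?_
  filter_upwards [koopman_mk_ae e (ind ν hC),
    indicatorConstLp_coeFn (p := 2) (hs := measurable_smul_const e hC)
      (hμs := measure_ne_top ν _) (c := (1 : ℂ)),
    e.2.quasiMeasurePreserving.ae (indicatorConstLp_coeFn (p := 2) (hs := hC)
      (hμs := measure_ne_top ν C) (c := (1 : ℂ)))] with z h1 h2 h3
  rw [h1, ind, ind, h2]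
  exact h3

theorem inner_ind {C D : Set Z} (hC : MeasurableSet C) (hD : MeasurableSet D) :
    inner ℂ (ind ν hC) (ind ν hD) = (ν.real (C ∩ D) : ℂ) := by
  rw [ind, ind, L2.inner_indicatorConstLp_indicatorConstLp]
  simp

theorem ind_congr {C D : Set Z} (hC : MeasurableSet C) (hD : MeasurableSet D) (h : C = D) :
    ind ν hC = ind ν hD := by
  subst h; rfl

theorem ind_add {C D : Set Z} (hC : MeasurableSet C) (hD : MeasurableSet D)
    (h : Disjoint C D) : ind ν (hC.union hD) = ind ν hC + ind ν hD :=
  indicatorConstLp_disjoint_union hC hD _ _ h _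

theorem mem_of_tendsto_ind {K : Submodule ℂ (Lp ℂ 2 ν)} (hK : IsClosed (K : Set (Lp ℂ 2 ν)))
    {C : ℕ → Set Z} {D : Set Z} (hC : ∀ n, MeasurableSet (C n)) (hD : MeasurableSet D)
    (h : Tendsto (fun n => ν (C n ∆ D)) atTop (𝓝 0)) (hmem : ∀ n, ind ν (hC n) ∈ K) :
    ind ν hD ∈ K :=
  hK.mem_of_tendsto (tendsto_indicatorConstLp_set (ht := hC) (hμt := fun _ => measure_ne_top ν _)
    ENNReal.ofNat_ne_top h) (Eventually.of_forall hmem)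

theorem ind_iUnion_mem {K : Submodule ℂ (Lp ℂ 2 ν)} (hK : IsClosed (K : Set (Lp ℂ 2 ν)))
    {C : ℕ → Set Z} (hC : ∀ n, MeasurableSet (C n)) (hd : Pairwise (Function.onFun Disjoint C))
    (hmem : ∀ n, ind ν (hC n) ∈ K) : ind ν (MeasurableSet.iUnion hC) ∈ K := by
  have hm : ∀ n, MeasurableSet (⋃ i ∈ Finset.range n, C i) := fun n =>
    Finset.measurableSet_biUnion _ fun i _ => hC i
  have hmemn : ∀ n, ind ν (hm n) ∈ K := by
    intro n
    induction n with
    | zero =>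
      rw [ind_congr (hm 0) MeasurableSet.empty (by simp)]
      simp [ind]
    | succ n ih =>
      have hdis : Disjoint (⋃ i ∈ Finset.range n, C i) (C n) := by
        simp only [disjoint_iUnion_left, Finset.mem_range]
        exact fun i hi => hd hi.ne
      rw [ind_congr (hm (n + 1)) ((hm n).union (hC n))
        (by simp [Finset.range_add_one, union_comm]), ind_add (hm n) (hC n) hdis]
      exact K.add_mem ih (hmem n)
  refine mem_of_tendsto_ind hK hm _ ?_ hmemn
  have hsub : ∀ n, (⋃ i ∈ Finset.range n, C i) ⊆ ⋃ i, C i := fun n =>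
    iUnion₂_subset fun i _ => subset_iUnion C i
  have h1 : ∀ n, (⋃ i ∈ Finset.range n, C i) ∆ (⋃ i, C i) =
      (⋃ i, C i) \ (⋃ i ∈ Finset.range n, C i) := fun n => symmDiff_of_le (hsub n)
  simp_rw [h1]
  have h2 : ⋂ n, ((⋃ i, C i) \ (⋃ i ∈ Finset.range n, C i)) = ∅ := by
    ext z
    simp only [mem_iInter, Set.mem_sdiff, mem_iUnion, Finset.mem_range, mem_empty_iff_false,
      iff_false, not_forall]
    by_cases hz : ∃ i, z ∈ C i
    · obtain ⟨i, hi⟩ := hz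
      exact ⟨i + 1, fun h => h.2 ⟨i, i.lt_succ_self, hi⟩⟩
    · exact ⟨0, fun h => hz h.1⟩
  rw [← measure_empty (μ := ν), ← h2]
  refine tendsto_measure_iInter_atTop
    (fun n => ((MeasurableSet.iUnion hC).diff (hm n)).nullMeasurableSet) ?_
    ⟨0, measure_ne_top ν _⟩
  intro m n hmn
  refine sdiff_subset_sdiff_right (biUnion_subset_biUnion_left ?_)
  exact fun i hi => Finset.range_mono hmn hi

/-- A closed subspace of `L²` that contains all indicator functions is everything. -/
theorem eq_top_of_ind_mem {K : Submodule ℂ (Lp ℂ 2 ν)} (hK : IsClosed (K : Set (Lp ℂ 2 ν)))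
    (h : ∀ C (hC : MeasurableSet C), ind ν hC ∈ K) (f : Lp ℂ 2 ν) : f ∈ K := by
  refine Lp.induction ENNReal.ofNat_ne_top (fun f => f ∈ K) ?_ ?_ hK f
  · intro c s hs hμs
    have h1 : (Lp.simpleFunc.indicatorConst 2 hs hμs.ne c : Lp ℂ 2 ν) = c • ind ν hs := by
      rw [Lp.simpleFunc.coe_indicatorConst]
      refine Lp.ext ?_
      filter_upwards [indicatorConstLp_coeFn (p := 2) (hs := hs) (hμs := hμs.ne) (c := c),
        indicatorConstLp_coeFn (p := 2) (hs := hs) (hμs := hμs.ne) (c := (1 : ℂ)),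
        Lp.coeFn_smul c (ind ν hs)] with z h1 h2 h3
      rw [h1, h3, Pi.smul_apply, ind, h2]
      by_cases hz : z ∈ s <;> simp [hz]
    rw [h1]
    exact K.smul_mem c (h s hs)
  · intro f g hf hg _ h1 h2
    exact K.add_mem h1 h2

theorem eq_top_of_ind_mem_of_iUnion {K : Submodule ℂ (Lp ℂ 2 ν)}
    (hK : IsClosed (K : Set (Lp ℂ 2 ν))) {V : ℕ → Set Z} (hV : ∀ n, MeasurableSet (V n))
    (hcov : ⋃ n, V n = univ)
    (h : ∀ n C (hC : MeasurableSet C), C ⊆ V n → ind ν hC ∈ K) (f : Lp ℂ 2 ν) : f ∈ K := by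
  refine eq_top_of_ind_mem hK (fun C hC => ?_) f
  have hm : ∀ n, MeasurableSet (C ∩ disjointed V n) := fun n => hC.inter (.disjointed hV n)
  have h1 : C = ⋃ n, C ∩ disjointed V n := by
    rw [← inter_iUnion, iUnion_disjointed, hcov, inter_univ]
  rw [ind_congr hC (MeasurableSet.iUnion hm) h1]
  refine ind_iUnion_mem hK hm ?_ fun n =>
    h n _ (hm n) (inter_subset_right.trans (disjointed_subset V n))
  exact fun i j hij => (disjoint_disjointed V hij).mono inter_subset_right inter_subset_right

/-- The singularity of the spectrum can be checked on the indicator functions of subsets of the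
members of a countable cover. -/
theorem hasSingularSpectrum_of_iUnion {R : Aut ν} {V : ℕ → Set Z}
    (hV : ∀ n, MeasurableSet (V n)) (hcov : ⋃ n, V n = univ)
    (h : ∀ n C (hC : MeasurableSet C), C ⊆ V n → SingVec (koopmanUnitary R) (ind ν hC)) :
    HasSingularSpectrum R :=
  hasSingularSpectrum_iff.2 fun f =>
    eq_top_of_ind_mem_of_iUnion (isClosed_singSubmodule (koopmanUnitary R)) hV hcov h f

end Koopman

/-! ### Direct products with the identity -/

section Product

variable {X : Type*} [MeasurableSpace X] {μ : Measure X} [IsProbabilityMeasure μ]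

/-- The direct product `e × Id` of an everywhere defined map with the identity. -/
def prodOne (e : MPEquiv μ) : MPEquiv (μ.prod μ) :=
  ⟨MeasurableEquiv.prodCongr e.1 (MeasurableEquiv.refl X), e.2.prod (MeasurePreserving.id μ)⟩

theorem prodOne_smul (e : MPEquiv μ) (p : X × X) : prodOne e • p = (e • p.1, p.2) := rfl

/-- `e ↦ e × Id` as a group homomorphism. -/
def prodOneHom (μ : Measure X) [IsProbabilityMeasure μ] : MPEquiv μ →* MPEquiv (μ.prod μ) where
  toFun := prodOne
  map_one' := rfl
  map_mul' _ _ := rfl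

theorem prodOne_zpow (e : MPEquiv μ) (s : ℤ) : prodOne e ^ s = prodOne (e ^ s) :=
  (map_zpow (prodOneHom μ) e s).symm

theorem prodId_mk (e : MPEquiv μ) : prodId (Aut.mk e) = Aut.mk (prodOne e) := by
  refine Aut.mk_eq_mk.2 ?_
  filter_upwards [Measure.quasiMeasurePreserving_fst.ae (Aut.rep_mk e)] with p hp
  exact Prod.ext hp rfl

/-- The correlations of 1_{A×B} under e × Id are those of 1_A under e multiplied by μ(B), so the
spectral measure is only rescaled. -/
theorem singVec_prodOne_rectangle {e : MPEquiv μ} (h : HasSingularSpectrum (Aut.mk e))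
    {A B : Set X} (hA : MeasurableSet A) (hB : MeasurableSet B) :
    SingVec (koopmanUnitary (Aut.mk (prodOne e))) (ind (μ.prod μ) (hA.prod hB)) := by
  obtain ⟨σ, ⟨hσ, hs⟩, hsing⟩ := h (ind μ hA)
  refine singVec_koopman_iff.2 ⟨(μ B).toNNReal • σ, ⟨inferInstance, fun s => ?_⟩,
    Measure.MutuallySingular.smul_nnreal _ hsing⟩
  have hset : (A ×ˢ B) ∩ (fun z : X × X => prodOne (e ^ s) • z) ⁻¹' (A ×ˢ B) =
      (A ∩ (fun x : X => (e ^ s) • x) ⁻¹' A) ×ˢ B := by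
    ext p
    simp only [mem_inter_iff, mem_prod, mem_preimage, prodOne_smul]
    tauto
  rw [integral_smul_nnreal_measure, hs, ← Aut.mk_zpow, ← Aut.mk_zpow, prodOne_zpow, koopman_ind,
    koopman_ind, inner_ind, inner_ind, hset, measureReal_prod_prod]
  rw [NNReal.smul_def, Complex.real_smul, Complex.ofReal_mul, mul_comm]
  rfl

/-- The product of an automorphism with singular spectrum and the identity has singular
spectrum. -/
theorem hasSingularSpectrum_prodOne {e : MPEquiv μ} (h : HasSingularSpectrum (Aut.mk e)) :
    HasSingularSpectrum (Aut.mk (prodOne e)) := by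
  refine hasSingularSpectrum_iff.2 ?_
  set K := singSubmodule (koopmanUnitary (Aut.mk (prodOne e))) with hKdef
  have hK : IsClosed (K : Set (Lp ℂ 2 (μ.prod μ))) := isClosed_singSubmodule _
  have huniv : ind (μ.prod μ) (MeasurableSet.univ (α := X × X)) ∈ K := by
    rw [ind_congr MeasurableSet.univ (MeasurableSet.univ.prod MeasurableSet.univ)
      univ_prod_univ.symm]
    exact singVec_prodOne_rectangle h MeasurableSet.univ MeasurableSet.univ
  refine fun f => eq_top_of_ind_mem hK (fun C hC => ?_) f
  -- The sets whose indicator lies in the closed subspace K form a λ-system containing the π-system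
  -- of rectangles.
  induction C, hC using MeasurableSpace.induction_on_inter generateFrom_prod.symm isPiSystem_prod with
  | empty =>
    have : ind (μ.prod μ) (MeasurableSet.empty (α := X × X)) = 0 := by simp [ind]
    rw [this]; exact K.zero_mem
  | basic t ht =>
    obtain ⟨A, hA, B, hB, rfl⟩ := ht
    exact singVec_prodOne_rectangle h hA hB
  | compl t htm ih =>
    have h1 := ind_add (ν := μ.prod μ) htm htm.compl disjoint_compl_right
    rw [ind_congr (htm.union htm.compl) MeasurableSet.univ (union_compl_self t)] at h1
    rw [← add_sub_cancel_left (ind (μ.prod μ) htm) (ind (μ.prod μ) htm.compl), ← h1]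
    exact K.sub_mem huniv ih
  | iUnion f hd hf ih => exact ind_iUnion_mem hK hf hd ih

end Product

/-! ## Continuity of the Koopman representation and the `Gδ` property -/

section Halmos

variable {Z : Type*} [MeasurableSpace Z] {ν : Measure Z}

theorem Aut.mk_preimage_ae (e : MPEquiv ν) (C : Set Z) :
    (Aut.mk e) ⁻¹' C =ᵐ[ν] (fun z : Z => e • z) ⁻¹' C := by
  refine eventuallyEq_set.2 ?_
  filter_upwards [Aut.rep_mk e] with z hz
  rw [mem_preimage, mem_preimage, hz]; rfl

theorem Aut.image_eq_preimage (R : Aut ν) (C : Set Z) :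
    R '' C = (fun z : Z => R.rep⁻¹ • z) ⁻¹' C :=
  R.rep.1.image_eq_preimage_symm C

theorem Aut.image_ae (R : Aut ν) (C : Set Z) : R '' C =ᵐ[ν] (R⁻¹ : Aut ν) ⁻¹' C := by
  have h : R⁻¹ = Aut.mk R.rep⁻¹ := by rw [Aut.mk_inv, Aut.mk_rep]
  rw [Aut.image_eq_preimage, h]
  exact (Aut.mk_preimage_ae _ _).symm

theorem Aut.preimage_ae (R : Aut ν) (C : Set Z) : R ⁻¹' C =ᵐ[ν] (R⁻¹ : Aut ν) '' C := by
  have h := Aut.image_ae R⁻¹ C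
  rw [inv_inv] at h
  exact h.symm

/-- Inversion exchanges the image and preimage terms of the metric. Being an isometry, it transfers
continuity from R to R⁻¹. -/
theorem halmosDist_inv (A : ℕ → Set Z) (R T : Aut ν) :
    halmosDist A R⁻¹ T⁻¹ = halmosDist A R T := by
  refine tsum_congr fun i => ?_
  congr 1
  rw [add_comm]
  congr 1
  · exact measureReal_congr ((Aut.image_ae R _).symmDiff (Aut.image_ae T _)).symm
  · exact measureReal_congr ((Aut.preimage_ae R _).symmDiff (Aut.preimage_ae T _)).symm

variable [IsProbabilityMeasure ν]

/-- Preimages differ by at most δ. Images differ by at most 2δ, since e⁻¹ and f⁻¹ disagree only on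
the union of the two images of the disagreement set. The weights sum to 2, whence 6 = 2 · (1 + 2).
-/
theorem halmosDist_mk_le {A : ℕ → Set Z} (e f : MPEquiv ν) {δ : ℝ}
    (hδ : ν.real {z | e • z ≠ f • z} ≤ δ) : halmosDist A (Aut.mk e) (Aut.mk f) ≤ 6 * δ := by
  have hpre : ∀ C, ν.real (((Aut.mk e) ⁻¹' C) ∆ ((Aut.mk f) ⁻¹' C)) ≤ δ := by
    intro C
    rw [measureReal_congr ((Aut.mk_preimage_ae e C).symmDiff (Aut.mk_preimage_ae f C))]
    refine (measureReal_mono ?_).trans hδ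
    intro z hz heq
    simp only [mem_symmDiff, mem_preimage] at hz
    rw [show e • z = f • z from heq] at hz
    tauto
  have him : ∀ C, ν.real (((Aut.mk e) '' C) ∆ ((Aut.mk f) '' C)) ≤ 2 * δ := by
    intro C
    have h1 : ∀ g : MPEquiv ν, (Aut.mk g) '' C =ᵐ[ν] (fun z : Z => g⁻¹ • z) ⁻¹' C := fun g =>
      (Aut.image_ae (Aut.mk g) C).trans (Aut.mk_preimage_ae g⁻¹ C)
    rw [measureReal_congr ((h1 e).symmDiff (h1 f))]
    have h2 : ∀ g : MPEquiv ν,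
        ν.real ((fun z : Z => g⁻¹ • z) ⁻¹' {z | e • z ≠ f • z}) = ν.real {z | e • z ≠ f • z} :=
      fun g => congrArg ENNReal.toReal (MeasurePreserving.measure_preimage_equiv (f := (g⁻¹).1)
        (g⁻¹).2 _)
    have h3 : ((fun z : Z => e⁻¹ • z) ⁻¹' C) ∆ ((fun z : Z => f⁻¹ • z) ⁻¹' C) ⊆
        (fun z : Z => e⁻¹ • z) ⁻¹' {z | e • z ≠ f • z} ∪
          (fun z : Z => f⁻¹ • z) ⁻¹' {z | e • z ≠ f • z} := by
      intro z hz
      by_contra hcon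
      simp only [mem_union, mem_preimage, mem_ofPred_eq, not_or, not_not, smul_inv_smul] at hcon
      have h4 : e⁻¹ • z = f⁻¹ • z := by
        rw [eq_inv_smul_iff]; exact hcon.1.symm
      simp only [mem_symmDiff, mem_preimage, h4] at hz
      tauto
    refine (measureReal_mono h3).trans ((measureReal_union_le _ _).trans ?_)
    rw [h2, h2]
    linarith
  calc halmosDist A (Aut.mk e) (Aut.mk f)
      ≤ ∑' i : ℕ, (1 / 2 : ℝ) ^ i * (3 * δ) := by
        refine (halmos_summable A _ _).tsum_le_tsum (fun i => ?_)
          (summable_geometric_two.mul_right _)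
        refine mul_le_mul_of_nonneg_left ?_ (by positivity)
        linarith [hpre (A i), him (A i)]
    _ = 6 * δ := by rw [tsum_mul_right, tsum_geometric_two]; ring

theorem preimage_symmDiff_le_halmosDist (A : ℕ → Set Z) (i : ℕ) (R T : Aut ν) :
    ν.real ((R ⁻¹' A i) ∆ (T ⁻¹' A i)) ≤ 2 ^ i * halmosDist A R T := by
  have h1 := (halmos_summable A R T).le_tsum i fun j _ => by positivity
  have h2 : (0 : ℝ) ≤ ν.real ((R '' A i) ∆ (T '' A i)) := measureReal_nonneg
  have h3 : (0 : ℝ) < (1 / 2 : ℝ) ^ i := by positivity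
  calc ν.real ((R ⁻¹' A i) ∆ (T ⁻¹' A i))
      = 2 ^ i * ((1 / 2 : ℝ) ^ i * ν.real ((R ⁻¹' A i) ∆ (T ⁻¹' A i))) := by
        rw [← mul_assoc, ← mul_pow]; norm_num
    _ ≤ 2 ^ i * halmosDist A R T := by
        refine mul_le_mul_of_nonneg_left (le_trans ?_ h1) (by positivity)
        exact mul_le_mul_of_nonneg_left (by linarith) h3.le

theorem koopman_ind_rep (R : Aut ν) {C : Set Z} (hC : MeasurableSet C) :
    koopman R (ind ν hC) = ind ν (R.rep.1.measurable hC) := by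
  conv_lhs => rw [← R.mk_rep]
  exact koopman_ind R.rep hC

theorem ind_mem_closure {A : ℕ → Set Z} (hA : ν.MeasureDense (range A))
    {K : Submodule ℂ (Lp ℂ 2 ν)} (hK : IsClosed (K : Set (Lp ℂ 2 ν)))
    (h : ∀ i, ind ν (hA.measurable (A i) ⟨i, rfl⟩) ∈ K) {C : Set Z} (hC : MeasurableSet C) :
    ind ν hC ∈ K := by
  choose B hB hd using fun n : ℕ =>
    hA.approx C hC (measure_ne_top ν C) (1 / ((n : ℝ) + 1)) (by positivity)
  choose i hi using hB
  refine mem_of_tendsto_ind hK (fun n => hA.measurable (A (i n)) ⟨i n, rfl⟩) hC ?_ fun n => h (i n)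
  have h0 : Tendsto (fun n : ℕ => ENNReal.ofReal (1 / ((n : ℝ) + 1))) atTop (𝓝 0) := by
    have := ENNReal.tendsto_ofReal tendsto_one_div_add_atTop_nhds_zero_nat
    rwa [ENNReal.ofReal_zero] at this
  refine tendsto_of_tendsto_of_tendsto_of_le_of_le tendsto_const_nhds h0 (fun n => bot_le) ?_
  intro n
  change ν (A (i n) ∆ C) ≤ _
  rw [hi, symmDiff_comm]
  exact (hd n).le

/-- The vectors with a continuous orbit map form a closed subspace, as isometries make approximation
uniform in R. It contains each indicator of `A i`, by the i-th term of the metric, and these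
indicators approximate all others. -/
theorem continuous_koopman {A : ℕ → Set Z} (hA : ν.MeasureDense (range A)) (f : Lp ℂ 2 ν) :
    letI : PseudoMetricSpace (Aut ν) := halmosMetric A
    Continuous fun R : Aut ν => koopman R f := by
  let _ : PseudoMetricSpace (Aut ν) := halmosMetric A
  let K : Submodule ℂ (Lp ℂ 2 ν) :=
    { carrier := {f | Continuous fun R : Aut ν => koopman R f}
      add_mem' := fun hf hg => by
        simp only [mem_ofPred_eq, map_add]
        exact hf.add hg
      zero_mem' := by simpa using continuous_const
      smul_mem' := fun c f hf => by
        simp only [mem_ofPred_eq, map_smul]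
        exact hf.const_smul c }
  have hK : IsClosed (K : Set (Lp ℂ 2 ν)) := by
    refine isClosed_of_closure_subset fun g hg => ?_
    refine continuous_of_uniform_approx_of_continuous fun u hu => ?_
    obtain ⟨ε, hε, hu⟩ := Metric.mem_uniformity_dist.1 hu
    obtain ⟨f, hf, hd⟩ := Metric.mem_closure_iff.1 hg ε hε
    exact ⟨fun R => koopman R f, hf, fun R => hu (by rwa [(koopman R).isometry.dist_eq])⟩
  refine eq_top_of_ind_mem hK (fun C hC => ind_mem_closure hA hK (fun i => ?_) hC) f
  change Continuous fun R : Aut ν => koopman R (ind ν _)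
  simp_rw [koopman_ind_rep]
  refine continuous_iff_continuousAt.2 fun T => ?_
  refine tendsto_indicatorConstLp_set ENNReal.ofNat_ne_top ?_
  have h1 : Tendsto (fun R : Aut ν => ENNReal.ofReal (2 ^ i * dist R T)) (𝓝 T) (𝓝 0) := by
    have : Continuous fun R : Aut ν => ENNReal.ofReal (2 ^ i * dist R T) :=
      ENNReal.continuous_ofReal.comp (by fun_prop)
    have h2 := this.tendsto T
    rwa [dist_self, mul_zero, ENNReal.ofReal_zero] at h2
  refine tendsto_of_tendsto_of_tendsto_of_le_of_le tendsto_const_nhds h1 (fun R => bot_le) ?_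
  intro R
  have h2 := ENNReal.ofReal_le_ofReal (preimage_symmDiff_le_halmosDist (ν := ν) A i R T)
  rwa [Measure.real, ENNReal.ofReal_toReal (measure_ne_top ν _)] at h2

theorem continuous_koopman_inv {A : ℕ → Set Z} (hA : ν.MeasureDense (range A)) (f : Lp ℂ 2 ν) :
    letI : PseudoMetricSpace (Aut ν) := halmosMetric A
    Continuous fun R : Aut ν => koopman R⁻¹ f := by
  let _ : PseudoMetricSpace (Aut ν) := halmosMetric A
  have h : Isometry fun R : Aut ν => R⁻¹ := Isometry.of_dist_eq fun R T => halmosDist_inv A R T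
  exact (continuous_koopman hA f).comp h.continuous

theorem continuous_isometry_apply {Y E : Type*} [TopologicalSpace Y] [NormedAddCommGroup E]
    [Module ℂ E] {V : Y → E →ₗᵢ[ℂ] E} (hV : ∀ f, Continuous fun R => V R f) {g : Y → E}
    (hg : Continuous g) : Continuous fun R => V R (g R) := by
  refine continuous_iff_continuousAt.2 fun T => ?_
  have h1 : Tendsto (fun R => ‖g R - g T‖ + ‖V R (g T) - V T (g T)‖) (𝓝 T) (𝓝 0) := by
    have : Continuous fun R => ‖g R - g T‖ + ‖V R (g T) - V T (g T)‖ :=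
      (hg.sub continuous_const).norm.add ((hV _).sub continuous_const).norm
    simpa using this.tendsto T
  refine tendsto_iff_norm_sub_tendsto_zero.2 (squeeze_zero (fun R => norm_nonneg _) (fun R => ?_) h1)
  calc ‖V R (g R) - V T (g T)‖ = ‖V R (g R - g T) + (V R (g T) - V T (g T))‖ := by
        rw [map_sub]; abel_nf
    _ ≤ _ := (norm_add_le _ _).trans (by rw [(V R).norm_map])

theorem continuous_koopman_zpow {A : ℕ → Set Z} (hA : ν.MeasureDense (range A)) (s : ℤ) (f : Lp ℂ 2 ν) :
    letI : PseudoMetricSpace (Aut ν) := halmosMetric A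
    Continuous fun R : Aut ν => koopman (R ^ s) f := by
  let _ : PseudoMetricSpace (Aut ν) := halmosMetric A
  induction s using Int.induction_on with
  | zero => simpa using continuous_const
  | succ n ih =>
    simp_rw [zpow_add_one, koopman_mul]
    exact continuous_isometry_apply (continuous_koopman hA) ih
  | pred n ih =>
    simp_rw [zpow_sub_one, koopman_mul]
    exact continuous_isometry_apply (continuous_koopman_inv hA) ih

theorem continuous_polyAt_koopman {A : ℕ → Set Z} (hA : ν.MeasureDense (range A)) (c : ℤ →₀ ℂ) (f : Lp ℂ 2 ν) :
    letI : PseudoMetricSpace (Aut ν) := halmosMetric A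
    Continuous fun R : Aut ν => polyAt (koopmanUnitary R) f c := by
  let _ : PseudoMetricSpace (Aut ν) := halmosMetric A
  simp only [polyAt, Finsupp.linearCombination_apply, Finsupp.sum, koopmanUnitary_zpow_apply]
  exact continuous_finsetSum _ fun k _ => (continuous_koopman_zpow hA k f).const_smul (c k)

/-- The automorphisms with singular spectrum form a `Gδ` set. -/
theorem isGδ_hasSingularSpectrum {A : ℕ → Set Z}
    (hA : ν.MeasureDense (range A)) [MeasurableSpace.CountablyGenerated Z] :
    letI : PseudoMetricSpace (Aut ν) := halmosMetric A
    IsGδ {R : Aut ν | HasSingularSpectrum R} := by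
  let _ : PseudoMetricSpace (Aut ν) := halmosMetric A
  have : Fact ((2 : ENNReal) ≠ ⊤) := ⟨ENNReal.ofNat_ne_top⟩
  let f : ℕ → Lp ℂ 2 ν := TopologicalSpace.denseSeq (Lp ℂ 2 ν)
  -- By closedness of the singular subspace, a dense sequence of vectors and the tolerances 1/(m+1)
  -- suffice. Each resulting set is a union over p of open sets.
  have h : {R : Aut ν | HasSingularSpectrum R} = ⋂ (i : ℕ) (m : ℕ),
      {R : Aut ν | ∃ c, GoodPoly (1 / ((m : ℝ) + 1)) c ∧
        ‖f i - polyAt (koopmanUnitary R) (f i) c‖ < 1 / ((m : ℝ) + 1)} := by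
    ext R
    simp only [mem_ofPred_eq, mem_iInter]
    constructor
    · intro hR i m
      exact singVec_iff.1 (hasSingularSpectrum_iff.1 hR (f i)) _ (by positivity)
    · intro hR
      refine hasSingularSpectrum_iff.2 fun g => ?_
      refine singVec_of_closure fun ε hε => ?_
      obtain ⟨_, ⟨i, rfl⟩, hi⟩ :=
        Metric.mem_closure_iff.1 (TopologicalSpace.denseRange_denseSeq (Lp ℂ 2 ν) g) ε hε
      refine ⟨f i, singVec_iff.2 fun η hη => ?_, by rwa [← dist_eq_norm]⟩
      obtain ⟨m, hm⟩ := exists_nat_one_div_lt hη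
      obtain ⟨c, hc, h1⟩ := hR i m
      exact ⟨c, ⟨hc.1.trans hm, hc.2⟩, h1.trans hm⟩
  rw [h]
  refine IsGδ.iInter fun i => IsGδ.iInter fun m => IsOpen.isGδ ?_
  have h2 : {R : Aut ν | ∃ c, GoodPoly (1 / ((m : ℝ) + 1)) c ∧
        ‖f i - polyAt (koopmanUnitary R) (f i) c‖ < 1 / ((m : ℝ) + 1)} =
      ⋃ (c : ℤ →₀ ℂ) (_ : GoodPoly (1 / ((m : ℝ) + 1)) c),
        {R | ‖f i - polyAt (koopmanUnitary R) (f i) c‖ < 1 / ((m : ℝ) + 1)} := by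
    ext R; simp
  rw [h2]
  exact isOpen_biUnion fun c _ => isOpen_lt
    (continuous_const.sub (continuous_polyAt_koopman hA c (f i))).norm continuous_const

end Halmos

/-! ## Skew products -/

section SkewProducts

/-- A measurable bijection of a standard Borel space as a measurable equivalence. -/
noncomputable def measurableEquivOfBijective {Z : Type*} [MeasurableSpace Z] [StandardBorelSpace Z]
    (g : Z → Z) (hm : Measurable g) (hb : Function.Bijective g) : Z ≃ᵐ Z where
  toEquiv := Equiv.ofBijective g hb
  measurable_toFun := hm
  measurable_invFun := by
    intro C hC
    have : (Equiv.ofBijective g hb).symm ⁻¹' C = g '' C :=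
      ((Equiv.ofBijective g hb).image_eq_preimage_symm C).symm
    change MeasurableSet ((Equiv.ofBijective g hb).symm ⁻¹' C)
    rw [this]
    exact (hm.measurableEmbedding hb.1).measurableSet_image.2 hC

variable {X : Type*} [MeasurableSpace X] {μ : Measure X}

/-- The automorphism `F` of the product is a skew product over `s`, everywhere. -/
def IsOver (F : MPEquiv (μ.prod μ)) (s : MPEquiv μ) : Prop :=
  ∀ z : X × X, (F • z).1 = s • z.1

theorem IsOver.mul {F G : MPEquiv (μ.prod μ)} {s t : MPEquiv μ} (hF : IsOver F s)
    (hG : IsOver G t) : IsOver (F * G) (s * t) := fun z => by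
  rw [mul_smul, hF, hG, mul_smul]

theorem IsOver.inv {F : MPEquiv (μ.prod μ)} {s : MPEquiv μ} (hF : IsOver F s) :
    IsOver F⁻¹ s⁻¹ := fun z => by
  rw [eq_inv_smul_iff, ← hF, smul_inv_smul]

theorem isOver_one : IsOver (1 : MPEquiv (μ.prod μ)) 1 := fun _ => rfl

theorem IsOver.zpow {F : MPEquiv (μ.prod μ)} {s : MPEquiv μ} (hF : IsOver F s) (k : ℤ) :
    IsOver (F ^ k) (s ^ k) := by
  induction k using Int.induction_on with
  | zero => simpa using isOver_one
  | succ n ih => rw [zpow_add_one, zpow_add_one]; exact ih.mul hF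
  | pred n ih => rw [zpow_sub_one, zpow_sub_one]; exact ih.mul hF.inv

/-- Using the fibre maps themselves as a representative gives a bijection that is skew at every
point, so later orbit arguments need no exceptional null set. -/
theorem exists_isOver_of_mem_Ext [StandardBorelSpace X] [SFinite μ] {s : MPEquiv μ} {R : Aut (μ.prod μ)} (hR : R ∈ Ext (Aut.mk s)) :
    ∃ F, Aut.mk F = R ∧ IsOver F s := by
  obtain ⟨r, hr, hRr⟩ := hR
  let g : X × X → X × X := fun p => (s • p.1, (r p.1).1 p.2)
  have hm : Measurable g := ((measurable_smul_const s).comp measurable_fst).prodMk hr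
  have hb : Function.Bijective g := by
    constructor
    · rintro ⟨x, y⟩ ⟨x', y'⟩ h
      obtain ⟨h1, h2⟩ := Prod.mk.inj h
      obtain rfl : x = x' := smul_left_cancel s h1
      exact Prod.ext rfl ((r x).1.injective h2)
    · rintro ⟨a, b⟩
      refine ⟨(s⁻¹ • a, (r (s⁻¹ • a)).1.symm b), Prod.ext (smul_inv_smul s a) ?_⟩
      exact (r (s⁻¹ • a)).1.apply_symm_apply b
  have hae : ∀ᵐ p ∂(μ.prod μ), g p = R p := by
    filter_upwards [hRr, Measure.quasiMeasurePreserving_fst.ae (Aut.rep_mk s)] with p h1 h2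
    rw [h1, h2]; rfl
  have hmp : MeasurePreserving g (μ.prod μ) (μ.prod μ) :=
    ⟨hm, by rw [Measure.map_congr hae]; exact R.measurePreserving.map_eq⟩
  refine ⟨⟨measurableEquivOfBijective g hm hb, hmp⟩, ?_, fun _ => rfl⟩
  rw [← R.mk_rep]
  exact Aut.mk_eq_mk.2 hae

variable [IsProbabilityMeasure μ]

theorem isOver_prodOne (s : MPEquiv μ) : IsOver (prodOne s) s := fun _ => rfl

/-- Integrated over any A in the base, both sides give μ(A) μ(C): the left one is the measure of
F⁻¹(sA × C), and F and s preserve measure. -/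
theorem IsOver.measure_fibre_preimage {F : MPEquiv (μ.prod μ)} {s : MPEquiv μ} (hF : IsOver F s)
    {C : Set X} (hC : MeasurableSet C) :
    ∀ᵐ x ∂μ, μ ((fun y => (F • (x, y)).2) ⁻¹' C) = μ C := by
  have hmeas : Measurable fun p : X × X => (F • p).2 := measurable_snd.comp (measurable_smul_const F)
  refine ae_eq_of_forall_setLIntegral_eq_of_sigmaFinite
    (measurable_measure_prodMk_left (hmeas hC)) measurable_const fun A hA _ => ?_
  have hset : (A ×ˢ univ) ∩ (fun p : X × X => (F • p).2) ⁻¹' C =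
      (fun z : X × X => F • z) ⁻¹' (((fun x : X => s⁻¹ • x) ⁻¹' A) ×ˢ C) := by
    ext p
    simp only [mem_inter_iff, mem_prod, mem_univ, and_true, mem_preimage, hF p, inv_smul_smul]
  have hmA : MeasurableSet ((fun x : X => s⁻¹ • x) ⁻¹' A) := measurable_smul_const s⁻¹ hA
  have h1 : (μ.prod μ) ((A ×ˢ univ) ∩ (fun p : X × X => (F • p).2) ⁻¹' C) = μ A * μ C := by
    rw [hset, (measurePreserving_smul_mp F).measure_preimage (hmA.prod hC).nullMeasurableSet,
      Measure.prod_prod, (measurePreserving_smul_mp s⁻¹).measure_preimage hA.nullMeasurableSet]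
  rw [Measure.prod_apply ((hA.prod MeasurableSet.univ).inter (hmeas hC))] at h1
  rw [setLIntegral_const, mul_comm, ← h1, ← lintegral_indicator hA]
  refine lintegral_congr fun x => ?_
  by_cases hx : x ∈ A
  · rw [indicator_of_mem hx]
    congr 1
    ext y
    simp [hx]
  · rw [indicator_of_notMem hx]
    symm
    convert measure_empty (μ := μ)
    ext y
    simp [hx]

variable [StandardBorelSpace X]

theorem IsOver.ae_measurePreserving_fibre {F : MPEquiv (μ.prod μ)} {s : MPEquiv μ}
    (hF : IsOver F s) : ∀ᵐ x ∂μ, MeasurePreserving (fun y => (F • (x, y)).2) μ μ := by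
  -- A countable generating π-system lets the exceptional null sets of the individual C be merged
  -- into one.
  let 𝒢 := generateSetAlgebra (MeasurableSpace.countableGeneratingSet X)
  have hcount : 𝒢.Countable :=
    countable_generateSetAlgebra (MeasurableSpace.countable_countableGeneratingSet)
  have hgen : MeasurableSpace.generateFrom 𝒢 = ‹MeasurableSpace X› := by
    rw [generateFrom_generateSetAlgebra_eq, MeasurableSpace.generateFrom_countableGeneratingSet]
  have hpi : IsPiSystem 𝒢 := fun A hA B hB _ => isSetAlgebra_generateSetAlgebra.inter_mem hA hB
  have hmeasC : ∀ C ∈ 𝒢, MeasurableSet C := by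
    intro C hC
    have := MeasurableSpace.measurableSet_generateFrom hC
    rwa [hgen] at this
  have h : ∀ᵐ x ∂μ, ∀ C ∈ 𝒢, μ ((fun y => (F • (x, y)).2) ⁻¹' C) = μ C :=
    (ae_ball_iff hcount).2 fun C hC => hF.measure_fibre_preimage (hmeasC C hC)
  filter_upwards [h] with x hx
  have hm : Measurable fun y => (F • (x, y)).2 :=
    measurable_snd.comp ((measurable_smul_const F).comp measurable_prodMk_left)
  have : IsProbabilityMeasure (Measure.map (fun y => (F • (x, y)).2) μ) :=
    Measure.isProbabilityMeasure_map hm.aemeasurable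
  refine ⟨hm, ext_of_generate_finite 𝒢 hgen.symm hpi (fun C hC => ?_) (by simp)⟩
  rw [Measure.map_apply hm (hmeasC C hC), hx C hC]

theorem IsOver.mk_mem_Ext {F : MPEquiv (μ.prod μ)} {s : MPEquiv μ} (hF : IsOver F s) :
    Aut.mk F ∈ Ext (Aut.mk s) := by
  classical
  let f : X → X → X := fun x y => (F • (x, y)).2
  have hm : ∀ x, Measurable (f x) := fun x =>
    measurable_snd.comp ((measurable_smul_const F).comp measurable_prodMk_left)
  have hb : ∀ x, Function.Bijective (f x) := by
    intro x
    constructor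
    · intro y y' h
      have h1 : F • (x, y) = F • (x, y') := Prod.ext (by rw [hF, hF]) h
      exact (Prod.mk.inj (smul_left_cancel F h1)).2
    · intro b
      have h1 := hF (F⁻¹ • (s • x, b))
      rw [smul_inv_smul] at h1
      have h2 : (F⁻¹ • (s • x, b)).1 = x := (smul_left_cancel s h1).symm
      refine ⟨(F⁻¹ • (s • x, b)).2, ?_⟩
      have h3 : (x, (F⁻¹ • (s • x, b)).2) = F⁻¹ • (s • x, b) := Prod.ext h2.symm rfl
      change (F • (x, (F⁻¹ • (s • x, b)).2)).2 = b
      rw [h3, smul_inv_smul]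
  -- The fibre maps that fail to preserve μ are replaced by the identity over a measurable null
  -- hull, which keeps the family jointly measurable.
  let N : Set X := toMeasurable μ {x | ¬ MeasurePreserving (f x) μ μ}
  have hN : μ N = 0 := by
    rw [measure_toMeasurable]; exact ae_iff.1 hF.ae_measurePreserving_fibre
  have hgood : ∀ x, x ∉ N → MeasurePreserving (f x) μ μ := fun x hx => by
    by_contra h
    exact hx (subset_toMeasurable _ _ h)
  let r : X → MPEquiv μ := fun x =>
    if hx : x ∈ N then 1 else ⟨measurableEquivOfBijective (f x) (hm x) (hb x), hgood x hx⟩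
  have hr : ∀ x y, (r x).1 y = if x ∈ N then y else f x y := by
    intro x y
    by_cases hx : x ∈ N
    · rw [if_pos hx, show r x = 1 from dif_pos hx]; rfl
    · rw [if_neg hx, show r x = _ from dif_neg hx]; rfl
  refine ⟨r, ?_, ?_⟩
  · simp_rw [hr]
    exact Measurable.ite (measurable_fst (measurableSet_toMeasurable _ _)) measurable_snd
      (measurable_snd.comp (measurable_smul_const F))
  · have hNae : ∀ᵐ x ∂μ, x ∉ N := measure_eq_zero_iff_ae_notMem.1 hN
    filter_upwards [Aut.rep_mk F, Measure.quasiMeasurePreserving_fst.ae (Aut.rep_mk s),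
      Measure.quasiMeasurePreserving_fst.ae hNae] with p h1 h2 h3
    rw [h1, h2, hr, if_neg h3]
    exact Prod.ext (hF p) rfl

theorem conj_prodId_mem_Ext (s : MPEquiv μ) {J : Aut (μ.prod μ)} (hJ : J ∈ Ext (1 : Aut μ)) :
    J⁻¹ * prodId (Aut.mk s) * J ∈ Ext (Aut.mk s) := by
  obtain ⟨F, rfl, hF⟩ := exists_isOver_of_mem_Ext (s := 1) hJ
  rw [prodId_mk, ← Aut.mk_inv, ← Aut.mk_mul, ← Aut.mk_mul]
  have := (hF.inv.mul (isOver_prodOne s)).mul hF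
  rw [inv_one, one_mul, mul_one] at this
  exact this.mk_mem_Ext

end SkewProducts

/-! ## Maps defined piecewise -/

section Piecewise

variable {Z : Type*} [MeasurableSpace Z] [StandardBorelSpace Z] {ν : Measure Z}

/-- A bijection that agrees with measure-preserving maps on the members of a countable measurable
partition preserves the measure. -/
theorem exists_piecewise {ι : Type*} [Countable ι] [MeasurableSpace ι]
    [MeasurableSingletonClass ι] (F : ι → MPEquiv ν) {κ : Z → ι} (hκ : Measurable κ)
    (hb : Function.Bijective fun z => F (κ z) • z) :
    ∃ G : MPEquiv ν, ∀ z, G • z = F (κ z) • z := by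
  have hpre : ∀ C : Set Z, (fun z => F (κ z) • z) ⁻¹' C =
      ⋃ i, κ ⁻¹' {i} ∩ (fun z => F i • z) ⁻¹' C := by
    intro C; ext z; simp
  have hm : Measurable fun z => F (κ z) • z := by
    intro C hC
    rw [hpre]
    exact MeasurableSet.iUnion fun i =>
      (hκ (measurableSet_singleton i)).inter (measurable_smul_const (F i) hC)
  refine ⟨⟨measurableEquivOfBijective _ hm hb, hm, ?_⟩, fun _ => rfl⟩
  ext C hC
  change (Measure.map (fun z => F (κ z) • z) ν) C = ν C
  have hD : ∀ i, MeasurableSet (κ ⁻¹' {i} ∩ (fun z => F i • z) ⁻¹' C) := fun i =>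
    (hκ (measurableSet_singleton i)).inter (measurable_smul_const (F i) hC)
  -- D' i is the part of C covered by the image of the i-th piece. Surjectivity makes these sets
  -- exhaust C, injectivity makes them disjoint.
  let D' : ι → Set Z := fun i => (fun z => (F i)⁻¹ • z) ⁻¹' (κ ⁻¹' {i} ∩ (fun z => F i • z) ⁻¹' C)
  have hD' : ∀ i, MeasurableSet (D' i) := fun i => measurable_smul_const (F i)⁻¹ (hD i)
  have hmemD' : ∀ i z, z ∈ D' i ↔ κ ((F i)⁻¹ • z) = i ∧ z ∈ C := by
    intro i z
    simp [D']
  have hCD : C = ⋃ i, D' i := by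
    ext z
    simp only [mem_iUnion, hmemD']
    constructor
    · intro hz
      obtain ⟨w, hw⟩ := hb.2 z
      refine ⟨κ w, ?_, hz⟩
      rw [← hw]
      simp
    · rintro ⟨i, -, hz⟩
      exact hz
  rw [Measure.map_apply hm hC, hpre, measure_iUnion _ hD]
  · conv_rhs => rw [hCD]
    rw [measure_iUnion _ hD']
    · exact tsum_congr fun i =>
        ((measurePreserving_smul_mp (F i)⁻¹).measure_preimage (hD i).nullMeasurableSet).symm
    · intro i j hij
      refine disjoint_left.2 fun z hi hj => hij ?_
      rw [hmemD'] at hi hj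
      have : (F i)⁻¹ • z = (F j)⁻¹ • z := by
        apply hb.1
        simp only [hi.1, hj.1, smul_inv_smul]
      rw [← hi.1, this, hj.1]
  · intro i j hij
    refine disjoint_left.2 fun z hi hj => hij ?_
    exact (show κ z = i from hi.1).symm.trans hj.1

end Piecewise

/-! ## Markers and towers -/

section Markers

variable {Z : Type*} [MeasurableSpace Z] {ν : Measure Z}

theorem zpow_smul_zpow_smul (E : MPEquiv ν) (i j : ℤ) (z : Z) :
    E ^ i • E ^ j • z = E ^ (i + j) • z := by
  rw [smul_smul, zpow_add]

theorem smul_zpow_smul (E : MPEquiv ν) (j : ℤ) (z : Z) : E • E ^ j • z = E ^ (j + 1) • z := by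
  rw [smul_smul, zpow_add_one, (Commute.refl E).zpow_right j |>.eq]

theorem zpow_smul_smul (E : MPEquiv ν) (j : ℤ) (z : Z) : E ^ j • E • z = E ^ (j + 1) • z := by
  rw [smul_smul, zpow_add_one]

/-- A set of points whose orbits come back to it only after time `n` is small. -/
theorem measureReal_marker_le [IsProbabilityMeasure ν] (E : MPEquiv ν) {B : Set Z}
    (hB : MeasurableSet B) {n : ℕ} (hn : 0 < n)
    (hsep : ∀ z ∈ B, ∀ j : ℤ, 0 < j → j < n → E ^ j • z ∉ B) : ν.real B ≤ 1 / n := by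
  have hm : ∀ i ∈ Finset.range n, MeasurableSet ((fun z : Z => E ^ (i : ℤ) • z) ⁻¹' B) :=
    fun i _ => measurable_smul_const _ hB
  have hlt : ∀ (i j : ℕ), i < j → j < n → ∀ z : Z, E ^ (i : ℤ) • z ∈ B → E ^ (j : ℤ) • z ∉ B := by
    intro i j hij hj z hi
    have := hsep _ hi ((j : ℤ) - i) (by omega) (by omega)
    rwa [zpow_smul_zpow_smul, sub_add_cancel] at this
  have hd : PairwiseDisjoint (↑(Finset.range n))
      fun i : ℕ => (fun z : Z => E ^ (i : ℤ) • z) ⁻¹' B := by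
    intro i hi j hj hij
    refine disjoint_left.2 fun z hzi hzj => ?_
    simp only [Finset.coe_range, mem_Iio] at hi hj
    rcases lt_or_gt_of_ne hij with h | h
    · exact hlt i j h hj z hzi hzj
    · exact hlt j i h hi z hzj hzi
  have h1 := measureReal_biUnion_finset (μ := ν) hd hm
  have h2 : ∀ i ∈ Finset.range n, ν.real ((fun z : Z => E ^ (i : ℤ) • z) ⁻¹' B) = ν.real B :=
    fun i _ => congrArg ENNReal.toReal
      ((measurePreserving_smul_mp (E ^ (i : ℤ))).measure_preimage hB.nullMeasurableSet)
  rw [Finset.sum_congr rfl h2, Finset.sum_const, Finset.card_range, nsmul_eq_mul] at h1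
  rw [le_div_iff₀ (by positivity), mul_comm, ← h1]
  exact measureReal_le_one

variable [StandardBorelSpace Z]

/-- Existence of marker sets for aperiodic points. -/
theorem exists_marker (E : MPEquiv ν) {D : Set Z} (hD : MeasurableSet D) {n : ℕ} (hn : 0 < n) :
    ∃ B ⊆ D, MeasurableSet B ∧ (∀ z ∈ B, ∀ j : ℤ, 0 < j → j < n → E ^ j • z ∉ B) ∧
      ∀ z ∈ D, (∀ j : ℤ, 0 < j → E ^ j • z ≠ z) → ∃ j : ℤ, -n < j ∧ j < n ∧ E ^ j • z ∈ B := by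
  let φ := embeddingReal Z
  have hφ : MeasurableEmbedding φ := measurableEmbedding_embeddingReal Z
  obtain ⟨e, he⟩ := exists_surjective_nat (ℚ × ℚ)
  let I : ℕ → Set ℝ := fun i => Ioo ((e i).1 : ℝ) ((e i).2 : ℝ)
  -- U i consists of the points of D lying in the i-th rational interval (under φ) whose orbit
  -- avoids that interval at the times 0 < j < n.
  let U : ℕ → Set Z := fun i =>
    D ∩ (φ ⁻¹' I i ∩ ⋂ j ∈ Finset.Ioo (0 : ℤ) n, (fun z : Z => E ^ j • z) ⁻¹' (φ ⁻¹' I i)ᶜ)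
  have hI : ∀ i, MeasurableSet (φ ⁻¹' I i) := fun i => hφ.measurable measurableSet_Ioo
  have hU : ∀ i, MeasurableSet (U i) := fun i =>
    hD.inter ((hI i).inter (Finset.measurableSet_biInter _ fun j _ =>
      measurable_smul_const _ (hI i).compl))
  have hUmem : ∀ i z, z ∈ U i → φ z ∈ I i ∧ ∀ j : ℤ, 0 < j → j < n → φ (E ^ j • z) ∉ I i := by
    intro i z hz
    refine ⟨hz.2.1, fun j h0 hj => ?_⟩
    have := mem_iInter₂.1 hz.2.2 j (Finset.mem_Ioo.2 ⟨h0, hj⟩)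
    exact this
  -- Greedy choice: at stage i, add the points of U i with no earlier marker within n steps on their
  -- orbit.
  let step : ℕ → Set Z → Set Z := fun i C =>
    C ∪ (U i ∩ ⋂ j ∈ Finset.Ioo (-n : ℤ) n, (fun z : Z => E ^ j • z) ⁻¹' Cᶜ)
  let B : ℕ → Set Z := fun i => Nat.rec ∅ step i
  have hBs : ∀ i, B (i + 1) = step i (B i) := fun i => rfl
  have hBm : ∀ i, MeasurableSet (B i) := by
    intro i
    induction i with
    | zero => exact MeasurableSet.empty
    | succ i ih =>
      rw [hBs]
      exact ih.union ((hU i).inter (Finset.measurableSet_biInter _ fun j _ =>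
        measurable_smul_const _ ih.compl))
  have hmono : Monotone B := monotone_nat_of_le_succ fun i => by
    rw [hBs]; exact subset_union_left
  have hentry : ∀ i z, z ∈ B i → ∃ k < i, z ∈ U k ∧
      ∀ j : ℤ, -n < j → j < n → E ^ j • z ∉ B k := by
    intro i
    induction i with
    | zero => intro z hz; exact absurd hz (notMem_empty z)
    | succ i ih =>
      intro z hz
      rw [hBs] at hz
      rcases hz with hz | hz
      · obtain ⟨k, hk, h⟩ := ih z hz
        exact ⟨k, hk.trans i.lt_succ_self, h⟩
      · exact ⟨i, i.lt_succ_self, hz.1, fun j h1 h2 =>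
          mem_iInter₂.1 hz.2 j (Finset.mem_Ioo.2 ⟨h1, h2⟩)⟩
  have hsuccmem : ∀ k z, z ∈ U k → (∀ j : ℤ, -n < j → j < n → E ^ j • z ∉ B k) →
      z ∈ B (k + 1) := by
    intro k z h1 h2
    rw [hBs]
    refine Or.inr ⟨h1, mem_iInter₂.2 fun j hj => ?_⟩
    rw [Finset.mem_Ioo] at hj
    exact h2 j hj.1 hj.2
  refine ⟨⋃ i, B i, iUnion_subset fun i z hz => ?_, MeasurableSet.iUnion hBm, ?_, ?_⟩
  · obtain ⟨k, -, hk, -⟩ := hentry i z hz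
    exact hk.1
  · intro z hz j h0 hj hz'
    obtain ⟨i, hi⟩ := mem_iUnion.1 hz
    obtain ⟨i', hi'⟩ := mem_iUnion.1 hz'
    obtain ⟨k, -, hk, hk2⟩ := hentry i z hi
    obtain ⟨k', -, hk', hk2'⟩ := hentry i' _ hi'
    rcases lt_trichotomy k k' with h | h | h
    · refine hk2' (-j) (by omega) (by omega) ?_
      rw [zpow_smul_zpow_smul, neg_add_cancel, zpow_zero, one_smul]
      exact hmono (Nat.succ_le_of_lt h) (hsuccmem k z hk hk2)
    · subst h
      exact (hUmem k z hk).2 j h0 hj (hUmem k _ hk').1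
    · exact hk2 j (by omega) hj (hmono (Nat.succ_le_of_lt h) (hsuccmem k' _ hk' hk2'))
  · intro z hzD hz
    -- An aperiodic z differs from its next n - 1 iterates, so some rational interval isolates it
    -- from them. At that stage z either already has a marker nearby or becomes one.
    let s : Finset ℝ := (Finset.Ioo (0 : ℤ) n).image fun j => φ (E ^ j • z)
    have hs : (↑s : Set ℝ)ᶜ ∈ 𝓝 (φ z) := by
      refine s.finite_toSet.isClosed.isOpen_compl.mem_nhds ?_
      simp only [s, Finset.coe_image, mem_compl_iff, mem_image, Finset.mem_coe, Finset.mem_Ioo,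
        not_exists, not_and]
      intro j hj h
      exact hz j hj.1 (hφ.injective h)
    obtain ⟨t, ht, hzt, hts⟩ := Real.isTopologicalBasis_Ioo_rat.mem_nhds_iff.1 hs
    simp only [mem_iUnion, mem_singleton_iff] at ht
    obtain ⟨a, b, -, rfl⟩ := ht
    obtain ⟨i, hi⟩ := he (a, b)
    have hIi : I i = Ioo (a : ℝ) b := by simp only [I, hi]
    have hzU : z ∈ U i := by
      refine ⟨hzD, ?_, mem_iInter₂.2 fun j hj hmem => ?_⟩
      · rw [mem_preimage, hIi]; exact hzt
      · rw [mem_preimage, hIi] at hmem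
        exact hts hmem (Finset.mem_coe.2 (Finset.mem_image_of_mem _ hj))
    rcases em (∃ j : ℤ, -n < j ∧ j < n ∧ E ^ j • z ∈ B i) with ⟨j, h1, h2, h3⟩ | hex
    · exact ⟨j, h1, h2, mem_iUnion.2 ⟨i, h3⟩⟩
    · refine ⟨0, by omega, by omega, ?_⟩
      rw [zpow_zero, one_smul]
      refine mem_iUnion.2 ⟨i + 1, hsuccmem i z hzU fun j h1 h2 h3 => hex ⟨j, h1, h2, h3⟩⟩

end Markers

/-! ### Closing the towers over a marker set -/

section Towers

variable {Z : Type*} [MeasurableSpace Z] {ν : Measure Z}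

/-- The second alternative makes the search succeed, at time 0, for orbits that never visited B. -/
theorem exists_backTime (E : MPEquiv ν) (B : Set Z) (z : Z) :
    ∃ k : ℕ, E ^ (-(k : ℤ)) • z ∈ B ∨ ∀ i : ℕ, E ^ (-(i : ℤ)) • z ∉ B := by
  by_cases h : ∃ k : ℕ, E ^ (-(k : ℤ)) • z ∈ B
  · exact ⟨h.choose, Or.inl h.choose_spec⟩
  · exact ⟨0, Or.inr fun i hi => h ⟨i, hi⟩⟩

open Classical in
/-- The time since the last visit to `B`, or `0` if there was none. -/
noncomputable def backTime (E : MPEquiv ν) (B : Set Z) (z : Z) : ℕ :=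
  Nat.find (exists_backTime E B z)

theorem measurable_backTime (E : MPEquiv ν) {B : Set Z} (hB : MeasurableSet B) :
    Measurable (backTime E B) := by
  classical
  refine measurable_find _ fun k => ?_
  have h1 : ∀ i : ℕ, MeasurableSet ((fun z : Z => E ^ (-(i : ℤ)) • z) ⁻¹' B) := fun i =>
    measurable_smul_const _ hB
  have h2 : {z | E ^ (-(k : ℤ)) • z ∈ B ∨ ∀ i : ℕ, E ^ (-(i : ℤ)) • z ∉ B} =
      (fun z : Z => E ^ (-(k : ℤ)) • z) ⁻¹' B ∪
        ⋂ i : ℕ, ((fun z : Z => E ^ (-(i : ℤ)) • z) ⁻¹' B)ᶜ := by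
    ext z; simp
  rw [h2]
  exact (h1 k).union (MeasurableSet.iInter fun i => (h1 i).compl)

theorem backTime_spec {E : MPEquiv ν} {B : Set Z} {z : Z}
    (h : ∃ k : ℕ, E ^ (-(k : ℤ)) • z ∈ B) : E ^ (-(backTime E B z : ℤ)) • z ∈ B := by
  classical
  rcases Nat.find_spec (exists_backTime E B z) with h1 | h1
  · exact h1
  · exact absurd h.choose_spec (h1 _)

theorem backTime_min {E : MPEquiv ν} {B : Set Z} {z : Z} {i : ℕ} (hi : i < backTime E B z) :
    E ^ (-(i : ℤ)) • z ∉ B := by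
  classical
  exact fun h => Nat.find_min (exists_backTime E B z) hi (Or.inl h)

theorem backTime_eq {E : MPEquiv ν} {B : Set Z} {z : Z} {k : ℕ} (hk : E ^ (-(k : ℤ)) • z ∈ B)
    (hmin : ∀ i < k, E ^ (-(i : ℤ)) • z ∉ B) : backTime E B z = k := by
  classical
  refine (Nat.find_eq_iff _).2 ⟨Or.inl hk, fun i hi h => ?_⟩
  rcases h with h | h
  · exact hmin i hi h
  · exact h k hk

open Classical in
/-- The exponent of the map that follows `E` and jumps from the top of each tower over `B` to its
bottom. -/
noncomputable def towerExponent (E : MPEquiv ν) (B : Set Z) (z : Z) : ℤ :=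
  if E • z ∈ B then -(backTime E B z : ℤ) else 1

theorem measurable_towerExponent (E : MPEquiv ν) {B : Set Z} (hB : MeasurableSet B) :
    Measurable (towerExponent E B) := by
  classical
  exact Measurable.ite (measurable_smul_const E hB)
    ((measurable_of_countable fun k : ℕ => -(k : ℤ)).comp (measurable_backTime E hB))
    measurable_const

/-- The map that follows `E` and jumps from the top of each tower over `B` to its bottom. -/
noncomputable def towerMap (E : MPEquiv ν) (B : Set Z) (z : Z) : Z := E ^ towerExponent E B z • z

theorem towerMap_of_notMem {E : MPEquiv ν} {B : Set Z} {z : Z} (h : E • z ∉ B) :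
    towerMap E B z = E • z := by
  rw [towerMap, towerExponent, if_neg h, zpow_one]

theorem towerMap_of_mem {E : MPEquiv ν} {B : Set Z} {z : Z} (h : E • z ∈ B) :
    towerMap E B z = E ^ (-(backTime E B z : ℤ)) • z := by
  rw [towerMap, towerExponent, if_pos h]

theorem towerMap_iterate {E : MPEquiv ν} {B : Set Z} {b : Z} {h : ℕ}
    (hmin : ∀ i : ℕ, 0 < i → i < h → E ^ (i : ℤ) • b ∉ B) {i : ℕ} (hi : i < h) :
    (towerMap E B)^[i] b = E ^ (i : ℤ) • b := by
  induction i with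
  | zero => simp
  | succ i ih =>
    have h1 := hmin (i + 1) i.succ_pos hi
    rw [Function.iterate_succ_apply', ih (by omega), towerMap_of_notMem, smul_zpow_smul]
    · push_cast; rfl
    · rw [smul_zpow_smul]; exact_mod_cast h1

theorem towerMap_iterate_return {E : MPEquiv ν} {B : Set Z} {b : Z} (hb : b ∈ B) {h : ℕ}
    (h0 : 0 < h) (hB : E ^ (h : ℤ) • b ∈ B)
    (hmin : ∀ i : ℕ, 0 < i → i < h → E ^ (i : ℤ) • b ∉ B) : (towerMap E B)^[h] b = b := by
  obtain ⟨k, rfl⟩ : ∃ k, h = k + 1 := ⟨h - 1, by omega⟩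
  have htime : backTime E B (E ^ (k : ℤ) • b) = k := by
    refine backTime_eq ?_ fun i hi => ?_
    · rwa [zpow_smul_zpow_smul, neg_add_cancel, zpow_zero, one_smul]
    · have := hmin (k - i) (by omega) (by omega)
      rw [zpow_smul_zpow_smul]
      rwa [show -(i : ℤ) + k = ((k - i : ℕ) : ℤ) by omega]
  rw [Function.iterate_succ_apply', towerMap_iterate hmin k.lt_succ_self, towerMap_of_mem, htime,
    zpow_smul_zpow_smul, neg_add_cancel, zpow_zero, one_smul]
  rw [smul_zpow_smul]; exact_mod_cast hB

/-- Points whose orbits visit `B` in the past and whose visits are followed by later ones are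
periodic for the tower map. -/
theorem mem_periodicPts_towerMap {E : MPEquiv ν} {B : Set Z}
    (hret : ∀ b ∈ B, ∃ h : ℕ, 0 < h ∧ E ^ (h : ℤ) • b ∈ B) {z : Z}
    (hz : ∃ k : ℕ, E ^ (-(k : ℤ)) • z ∈ B) : z ∈ Function.periodicPts (towerMap E B) := by
  classical
  set k := backTime E B z with hk
  have hb : E ^ (-(k : ℤ)) • z ∈ B := backTime_spec hz
  set b := E ^ (-(k : ℤ)) • z with hbdef
  have hex := hret b hb
  set h := Nat.find hex
  obtain ⟨h0, hB⟩ : 0 < h ∧ E ^ (h : ℤ) • b ∈ B := Nat.find_spec hex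
  have hmin : ∀ i : ℕ, 0 < i → i < h → E ^ (i : ℤ) • b ∉ B := fun i hi0 hi hmem =>
    Nat.find_min hex hi ⟨hi0, hmem⟩
  -- z lies below the top of the tower over b; otherwise the return of b to B would be a more recent
  -- visit than b itself.
  have hkh : k < h := by
    by_contra hcon
    have h1 : E ^ (-((k - h : ℕ) : ℤ)) • z ∉ B := backTime_min (by omega)
    rw [hbdef, zpow_smul_zpow_smul] at hB
    rw [show -((k - h : ℕ) : ℤ) = h + -(k : ℤ) by omega] at h1
    exact h1 hB
  have hzb : z = (towerMap E B)^[k] b := by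
    rw [towerMap_iterate hmin hkh, hbdef, zpow_smul_zpow_smul, add_neg_cancel, zpow_zero, one_smul]
  refine ⟨h, h0, ?_⟩
  rw [Function.IsPeriodicPt, Function.IsFixedPt, hzb, ← Function.iterate_add_apply, add_comm,
    Function.iterate_add_apply, towerMap_iterate_return hb h0 hB hmin]

/-- Any map is bijective on its set of periodic points, which contains Ω; off the invariant set Ω
the tower map is E. -/
theorem towerMap_bijective {E : MPEquiv ν} {B Ω : Set Z} (hBΩ : B ⊆ Ω)
    (hΩ : ∀ z, E • z ∈ Ω ↔ z ∈ Ω) (hper : Ω ⊆ Function.periodicPts (towerMap E B)) :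
    Function.Bijective (towerMap E B) := by
  have hzpow : ∀ (k : ℤ) z, E ^ k • z ∈ Ω ↔ z ∈ Ω := by
    intro k
    induction k using Int.induction_on with
    | zero => simp
    | succ n ih => intro z; rw [zpow_add_one, mul_smul, ih, hΩ]
    | pred n ih => intro z; rw [zpow_sub_one, mul_smul, ih, ← hΩ, smul_inv_smul]
  have hmaps : ∀ z, towerMap E B z ∈ Ω ↔ z ∈ Ω := fun z => hzpow _ z
  have hoff : ∀ z, z ∉ Ω → towerMap E B z = E • z := fun z hz =>
    towerMap_of_notMem fun h => hz ((hΩ z).1 (hBΩ h))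
  have hbij := Function.bijOn_periodicPts (towerMap E B)
  constructor
  · intro z z' h
    by_cases hz : z ∈ Ω
    · have hz' : z' ∈ Ω := by rwa [← hmaps, ← h, hmaps]
      exact hbij.injOn (hper hz) (hper hz') h
    · have hz' : z' ∉ Ω := by rwa [← hmaps, ← h, hmaps]
      rw [hoff z hz, hoff z' hz'] at h
      exact smul_left_cancel E h
  · intro w
    by_cases hw : w ∈ Ω
    · obtain ⟨z, -, hz⟩ := hbij.surjOn (hper hw)
      exact ⟨z, hz⟩
    · refine ⟨E⁻¹ • w, ?_⟩
      rw [hoff, smul_inv_smul]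
      rwa [← hΩ, smul_inv_smul]

end Towers

/-! ## Modifications of extensions on small sets -/

section Modification

variable {X : Type*} [MeasurableSpace X] [StandardBorelSpace X] {μ : Measure X}

/-- The set of periodic points. -/
def perSet {Z : Type*} [MeasurableSpace Z] {ν : Measure Z} (s : MPEquiv ν) : Set Z :=
  {x | ∃ p : ℤ, 0 < p ∧ s ^ p • x = x}

theorem measurableSet_fixed {Z : Type*} [MeasurableSpace Z] [StandardBorelSpace Z]
    {ν : Measure Z} (s : MPEquiv ν) : MeasurableSet {x : Z | s • x = x} :=
  measurableSet_eq_fun (measurable_smul_const s) measurable_id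

theorem measurableSet_perSet {Z : Type*} [MeasurableSpace Z] [StandardBorelSpace Z]
    {ν : Measure Z} (s : MPEquiv ν) : MeasurableSet (perSet s) := by
  have : perSet s = ⋃ (p : ℤ) (_ : 0 < p), {x | s ^ p • x = x} := by
    ext x; simp [perSet]
  rw [this]
  exact MeasurableSet.iUnion fun p => MeasurableSet.iUnion fun _ => measurableSet_fixed (s ^ p)

theorem smul_mem_perSet {Z : Type*} [MeasurableSpace Z] {ν : Measure Z} (s : MPEquiv ν) (x : Z) :
    s • x ∈ perSet s ↔ x ∈ perSet s := by
  refine exists_congr fun p => and_congr_right fun _ => ?_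
  rw [zpow_smul_smul, ← smul_zpow_smul]
  exact (MulAction.injective s).eq_iff

theorem zpow_smul_mem_perSet {Z : Type*} [MeasurableSpace Z] {ν : Measure Z} (s : MPEquiv ν)
    (k : ℤ) (x : Z) : s ^ k • x ∈ perSet s ↔ x ∈ perSet s := by
  refine exists_congr fun p => and_congr_right fun _ => ?_
  rw [zpow_smul_zpow_smul, add_comm, ← zpow_smul_zpow_smul]
  exact (MulAction.injective (s ^ k)).eq_iff

theorem zpow_mul_smul_of_fixed {Z : Type*} [MeasurableSpace Z] {ν : Measure Z} {s : MPEquiv ν}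
    {p : ℤ} {x : Z} (h : s ^ p • x = x) (l : ℤ) : s ^ (p * l) • x = x := by
  rw [zpow_mul]
  exact (MulAction.stabilizer (MPEquiv ν) x).zpow_mem (x := s ^ p) h l

/-- Every periodic orbit has a point in the fundamental domain. -/
theorem exists_fundamentalDomain (s : MPEquiv μ) :
    ∃ D ⊆ perSet s, MeasurableSet D ∧ (∀ x ∈ perSet s, ∃ i : ℤ, s ^ i • x ∈ D) ∧
      ∀ x ∈ D, ∀ k : ℤ, s ^ k • x ∈ D → s ^ k • x = x := by
  let φ := embeddingReal X
  have hφ : MeasurableEmbedding φ := measurableEmbedding_embeddingReal X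
  -- D selects from each periodic orbit the point minimizing the injective function φ; the minimum
  -- exists because the orbit is finite.
  refine ⟨perSet s ∩ ⋂ j : ℤ, {x | φ x ≤ φ (s ^ j • x)}, inter_subset_left,
    (measurableSet_perSet s).inter (MeasurableSet.iInter fun j =>
      measurableSet_le hφ.measurable (hφ.measurable.comp (measurable_smul_const _))), ?_, ?_⟩
  · rintro x ⟨p, hp, hx⟩
    obtain ⟨i, -, hi⟩ := Finset.exists_min_image (Finset.Ico 0 p) (fun i => φ (s ^ i • x))
      ⟨0, Finset.mem_Ico.2 ⟨le_rfl, hp⟩⟩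
    refine ⟨i, (zpow_smul_mem_perSet s i x).2 ⟨p, hp, hx⟩, mem_iInter.2 fun j => ?_⟩
    have h1 : s ^ j • s ^ i • x = s ^ ((j + i) % p) • x := by
      rw [zpow_smul_zpow_smul]
      conv_lhs => rw [← Int.emod_add_mul_ediv (j + i) p, ← zpow_smul_zpow_smul,
        zpow_mul_smul_of_fixed hx]
    rw [mem_ofPred_eq, h1]
    exact hi _ (Finset.mem_Ico.2 ⟨Int.emod_nonneg _ hp.ne', Int.emod_lt_of_pos _ hp⟩)
  · rintro x ⟨-, hx⟩ k ⟨-, hkx⟩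
    refine hφ.injective (le_antisymm ?_ (mem_iInter.1 hx k))
    have := mem_iInter.1 hkx (-k)
    rwa [mem_ofPred_eq, zpow_smul_zpow_smul, neg_add_cancel, zpow_zero, one_smul] at this

/-- Skew products over `s` can be glued along a countable measurable partition of the base. -/
theorem exists_piecewise_over {ι : Type*} [Countable ι] [MeasurableSpace ι]
    [MeasurableSingletonClass ι] {s : MPEquiv μ} {F : ι → MPEquiv (μ.prod μ)}
    (hF : ∀ i, IsOver (F i) s) {κ : X → ι} (hκ : Measurable κ) :
    ∃ G : MPEquiv (μ.prod μ), IsOver G s ∧ ∀ z : X × X, G • z = F (κ z.1) • z := by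
  have hb : Function.Bijective fun z : X × X => F (κ z.1) • z := by
    constructor
    · intro z z' h
      have h1 : z.1 = z'.1 := by
        have := congrArg Prod.fst h
        simp only [hF _ z, hF _ z'] at this
        exact smul_left_cancel s this
      simp only [h1] at h
      exact smul_left_cancel _ h
    · intro w
      refine ⟨(F (κ (s⁻¹ • w.1)))⁻¹ • w, ?_⟩
      simp only [(hF _).inv w, smul_inv_smul]
  obtain ⟨G, hG⟩ := exists_piecewise F (hκ.comp measurable_fst) hb
  exact ⟨G, fun z => by rw [hG]; exact hF _ z, hG⟩

variable [IsProbabilityMeasure μ]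

/-- An extension of `s` agrees, off a small set, with a conjugate of `s × Id`. -/
theorem exists_conj_prodOne {s : MPEquiv μ} {E : MPEquiv (μ.prod μ)} (hE : IsOver E s) {n : ℕ}
    (hn : 0 < n) :
    ∃ J : MPEquiv (μ.prod μ), IsOver J 1 ∧ ∃ N : Set X, MeasurableSet N ∧ μ.real N ≤ 1 / n ∧
      ∀ z : X × X, z.1 ∉ perSet s → z.1 ∉ N → (J⁻¹ * prodOne s * J) • z = E • z := by
  obtain ⟨B, -, hB, hsep, hcov⟩ := exists_marker s (measurableSet_perSet s).compl hn
  -- J goes back to the last visit along E and returns along s × Id. Hence J E = (s × Id) J wherever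
  -- the back time grows by one, that is, unless the next step enters B.
  let F : ℕ → MPEquiv (μ.prod μ) := fun k => prodOne s ^ (k : ℤ) * E ^ (-(k : ℤ))
  have hF : ∀ k, IsOver (F k) 1 := by
    intro k
    have := ((isOver_prodOne s).zpow k).mul (hE.zpow (-(k : ℤ)))
    rwa [← zpow_add, add_neg_cancel, zpow_zero] at this
  obtain ⟨J, hJ1, hJ⟩ := exists_piecewise_over hF (measurable_backTime s hB)
  refine ⟨J, hJ1, (fun x : X => s • x) ⁻¹' B, measurable_smul_const s hB, ?_, ?_⟩
  · rw [Measure.real, (measurePreserving_smul_mp s).measure_preimage hB.nullMeasurableSet]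
    exact measureReal_marker_le s hB hn hsep
  · intro z hz hzN
    have hhit : ∃ k : ℕ, s ^ (-(k : ℤ)) • z.1 ∈ B := by
      -- Applying the marker property n steps earlier puts the visit strictly in the past.
      have hz' : s ^ (-(n : ℤ)) • z.1 ∉ perSet s := by rwa [zpow_smul_mem_perSet]
      obtain ⟨j, -, h2, h3⟩ := hcov _ hz' fun j hj h => hz' ⟨j, hj, h⟩
      refine ⟨(n - j).toNat, ?_⟩
      rw [zpow_smul_zpow_smul] at h3
      rwa [show -((n - j).toNat : ℤ) = j + -n by omega]
    have htime : backTime s B (s • z.1) = backTime s B z.1 + 1 := by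
      refine backTime_eq ?_ fun i hi => ?_
      · rw [zpow_smul_smul]
        have := backTime_spec hhit
        rwa [show -((backTime s B z.1 + 1 : ℕ) : ℤ) + 1 = -(backTime s B z.1 : ℤ) by
          push_cast; ring]
      · rcases i with _ | i
        · simpa using hzN
        · rw [zpow_smul_smul, show -((i + 1 : ℕ) : ℤ) + 1 = -(i : ℤ) by push_cast; ring]
          exact backTime_min (by omega)
    have h1 : J • E • z = prodOne s • J • z := by
      rw [hJ, hJ]
      rw [hE, htime]
      simp only [F]
      rw [mul_smul, mul_smul, zpow_smul_smul, smul_zpow_smul]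
      congr 3
      push_cast; ring
    rw [mul_smul, mul_smul, ← h1, inv_smul_smul]

/-- An extension of `s` agrees, off a small set, with an extension which is periodic over the
periodic points of `s`. -/
theorem exists_periodic_modification {s : MPEquiv μ} {E : MPEquiv (μ.prod μ)} (hE : IsOver E s)
    {n : ℕ} (hn : 0 < n) :
    ∃ Q : MPEquiv (μ.prod μ), IsOver Q s ∧
      (∀ z : X × X, z.1 ∈ perSet s → z ∈ Function.periodicPts fun w : X × X => Q • w) ∧
      (μ.prod μ).real {z | Q • z ≠ E • z} ≤ 1 / n := by
  obtain ⟨D, hDper, hD, hDhit, hDuniq⟩ := exists_fundamentalDomain s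
  have hDm : MeasurableSet (Prod.fst ⁻¹' D ∩ (perSet E)ᶜ : Set (X × X)) :=
    (measurable_fst hD).inter (measurableSet_perSet E).compl
  -- Markers are taken for E, not s, among the E-aperiodic points over the fundamental domain D.
  obtain ⟨B, hBD, hB, hsep, hcov⟩ := exists_marker E hDm hn
  let Ω : Set (X × X) := Prod.fst ⁻¹' perSet s ∩ (perSet E)ᶜ
  have hBΩ : B ⊆ Ω := fun z hz => ⟨hDper (hBD hz).1, (hBD hz).2⟩
  have hΩ : ∀ z, E • z ∈ Ω ↔ z ∈ Ω := fun z => by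
    simp only [Ω, mem_inter_iff, mem_preimage, mem_compl_iff, hE z, smul_mem_perSet]
  -- The orbit of z lies over D at all times i + p l, and each such time is within n of a visit to
  -- B.
  have hvisit : ∀ z ∈ Ω, ∃ i : ℤ, ∃ p : ℤ, 0 < p ∧ ∀ l : ℤ, ∃ j : ℤ, -n < j ∧ j < n ∧
      E ^ (j + (i + p * l)) • z ∈ B := by
    intro z hz
    obtain ⟨i, hi⟩ := hDhit z.1 hz.1
    obtain ⟨p, hp, hpz⟩ := hz.1
    refine ⟨i, p, hp, fun l => ?_⟩
    have h1 : E ^ (i + p * l) • z ∉ perSet E := by rw [zpow_smul_mem_perSet]; exact hz.2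
    have h2 : (E ^ (i + p * l) • z).1 ∈ D := by
      rwa [hE.zpow _ z, ← zpow_smul_zpow_smul, zpow_mul_smul_of_fixed hpz]
    obtain ⟨j, hj1, hj2, hj3⟩ := hcov _ ⟨h2, h1⟩ fun j hj h => h1 ⟨j, hj, h⟩
    rw [zpow_smul_zpow_smul] at hj3
    exact ⟨j, hj1, hj2, hj3⟩
  have hpast : ∀ z ∈ Ω, ∃ k : ℕ, E ^ (-(k : ℤ)) • z ∈ B := by
    intro z hz
    obtain ⟨i, p, hp, h⟩ := hvisit z hz
    -- A shift by n + |i| periods outweighs both offsets i and j.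
    obtain ⟨j, -, hj, hjB⟩ := h (-(n + |i|))
    have h0 : 0 ≤ n + |i| := by positivity
    have h1 : n + |i| ≤ p * (n + |i|) := le_mul_of_one_le_left h0 hp
    have h2 := le_abs_self i
    refine ⟨(-(j + (i + p * -(n + |i|)))).toNat, ?_⟩
    rwa [Int.toNat_of_nonneg (by linarith), neg_neg]
  have hfuture : ∀ z ∈ Ω, ∃ k : ℕ, 0 < k ∧ E ^ (k : ℤ) • z ∈ B := by
    intro z hz
    obtain ⟨i, p, hp, h⟩ := hvisit z hz
    obtain ⟨j, hj, -, hjB⟩ := h (n + |i|)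
    have h0 : 0 ≤ n + |i| := by positivity
    have h1 : n + |i| ≤ p * (n + |i|) := le_mul_of_one_le_left h0 hp
    have h2 := neg_abs_le i
    have h3 : 0 < j + (i + p * (n + |i|)) := by linarith
    refine ⟨(j + (i + p * (n + |i|))).toNat, by omega, ?_⟩
    rwa [Int.toNat_of_nonneg h3.le]
  have hper : Ω ⊆ Function.periodicPts (towerMap E B) := fun z hz =>
    mem_periodicPts_towerMap (fun b hb => hfuture b (hBΩ hb)) (hpast z hz)
  obtain ⟨Q, hQ⟩ := exists_piecewise (fun k : ℤ => E ^ k) (measurable_towerExponent E hB)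
    (towerMap_bijective hBΩ hΩ hper)
  have hQ' : (fun w : X × X => Q • w) = towerMap E B := funext hQ
  refine ⟨Q, fun z => ?_, fun z hz => ?_, ?_⟩
  · rw [hQ]
    change (towerMap E B z).1 = _
    by_cases hz : E • z ∈ B
    · have hzΩ : z ∈ Ω := (hΩ z).1 (hBΩ hz)
      have h1 := (hBD (backTime_spec (hpast z hzΩ))).1
      have h2 := (hBD hz).1
      rw [mem_preimage, hE z] at h2
      rw [mem_preimage, hE.zpow _ z] at h1
      rw [towerMap_of_mem hz, hE.zpow _ z]
      have h3 := hDuniq _ h2 (-(backTime E B z : ℤ) - 1)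
      rw [zpow_smul_smul, sub_add_cancel] at h3
      exact h3 h1
    · rw [towerMap_of_notMem hz, hE]
  · rw [hQ']
    by_cases hzE : z ∈ perSet E
    · obtain ⟨p, hp, hpz⟩ := hzE
      have hiter : ∀ i : ℕ, (towerMap E B)^[i] z = E ^ (i : ℤ) • z := by
        intro i
        induction i with
        | zero => simp
        | succ i ih =>
          rw [Function.iterate_succ_apply', ih, towerMap_of_notMem, smul_zpow_smul]
          · push_cast; rfl
          · intro h
            have h1 := (hBΩ h).2
            rw [smul_zpow_smul, mem_compl_iff, zpow_smul_mem_perSet] at h1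
            exact h1 ⟨p, hp, hpz⟩
      refine ⟨p.toNat, by omega, ?_⟩
      rw [Function.IsPeriodicPt, Function.IsFixedPt, hiter, Int.toNat_of_nonneg hp.le, hpz]
    · exact hper ⟨hz, hzE⟩
  · have hsub : {z | Q • z ≠ E • z} ⊆ (fun z : X × X => E • z) ⁻¹' B := by
      intro z hz
      by_contra h
      apply hz
      rw [hQ]
      exact towerMap_of_notMem h
    refine (measureReal_mono hsub).trans ?_
    rw [Measure.real, (measurePreserving_smul_mp E).measure_preimage hB.nullMeasurableSet]
    exact measureReal_marker_le E hB hn hsep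

end Modification

/-! ## Density of extensions with singular spectrum -/

section Density

/-- If almost every point had period p, the union of p translates of a set C with 0 < p μ(C) < 1
would be an invariant set of measure strictly between 0 and 1, up to a null set. Absence of atoms
supplies C. -/
theorem measure_perSet_eq_zero {X : Type*} [MeasurableSpace X] [StandardBorelSpace X]
    {μ : Measure X} [IsProbabilityMeasure μ] [NullSingletonClass μ] {s : MPEquiv μ}
    (hs : Ergodic (fun x : X => s • x) μ) : μ (perSet s) = 0 := by
  have hsmall : ∀ p : ℕ, 0 < p → ∃ C : Set X, MeasurableSet C ∧ μ C ≠ 0 ∧ p * μ C < 1 := by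
    intro p hp
    let _ := upgradeStandardBorel X
    by_contra! hcon
    have h0 : μ (univ : Set X) = 0 := by
      -- If no such C existed, small neighbourhoods of the points, having measure below 1/p, would
      -- all be null.
      refine measure_null_of_locally_null _ fun x _ => ?_
      obtain ⟨U, hxU, hU, hμU⟩ := ({x} : Set X).exists_isOpen_lt_of_lt (μ := μ) ((p : ENNReal)⁻¹)
        (by rw [measure_singleton]; exact ENNReal.inv_pos.2 (ENNReal.natCast_ne_top p))
      refine ⟨U, mem_nhdsWithin_of_mem_nhds (hU.mem_nhds (hxU rfl)), ?_⟩
      by_contra hne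
      refine absurd (hcon U hU.measurableSet hne) (not_le.2 ?_)
      calc (p : ENNReal) * μ U < p * (p : ENNReal)⁻¹ :=
            (ENNReal.mul_lt_mul_iff_right (by exact_mod_cast hp.ne')
              (ENNReal.natCast_ne_top p)).2 hμU
        _ = 1 := ENNReal.mul_inv_cancel (by exact_mod_cast hp.ne') (ENNReal.natCast_ne_top p)
    rw [measure_univ] at h0
    exact one_ne_zero h0
  have hper : perSet s = ⋃ (p : ℕ) (_ : 0 < p), {x | s ^ (p : ℤ) • x = x} := by
    ext x
    simp only [perSet, mem_ofPred_eq, mem_iUnion, exists_prop]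
    constructor
    · rintro ⟨p, hp, hx⟩
      exact ⟨p.toNat, by omega, by rwa [Int.toNat_of_nonneg hp.le]⟩
    · rintro ⟨p, hp, hx⟩
      exact ⟨p, by exact_mod_cast hp, hx⟩
  rw [hper]
  refine measure_iUnion_null fun p => measure_iUnion_null fun hp => ?_
  set P : Set X := {x | s ^ (p : ℤ) • x = x} with hP
  have hPm : MeasurableSet P := measurableSet_fixed _
  have hPinv : ∀ x, s • x ∈ P ↔ x ∈ P := fun x => by
    rw [hP, mem_ofPred_eq, mem_ofPred_eq, zpow_smul_smul, ← smul_zpow_smul]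
    exact (MulAction.injective s).eq_iff
  rcases hs.prob_eq_zero_or_one hPm (Set.ext hPinv) with h | h
  · exact h
  exfalso
  obtain ⟨C, hC, hC0, hC1⟩ := hsmall p hp
  let V : Set X := P ∩ ⋃ j ∈ Finset.range p, (fun x : X => s ^ (j : ℤ) • x) ⁻¹' C
  have hVm : MeasurableSet V := hPm.inter (Finset.measurableSet_biUnion _ fun j _ =>
    measurable_smul_const _ hC)
  have hVmem : ∀ x, x ∈ V ↔ x ∈ P ∧ ∃ j : ℤ, s ^ j • x ∈ C := by
    intro x
    simp only [V, mem_inter_iff, mem_iUnion, Finset.mem_range, mem_preimage, exists_prop]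
    refine and_congr_right fun hx => ⟨fun ⟨j, _, hj⟩ => ⟨j, hj⟩, fun ⟨j, hj⟩ => ?_⟩
    have hp' : (0 : ℤ) < p := by exact_mod_cast hp
    have h0 := Int.emod_nonneg j hp'.ne'
    have h1 := Int.emod_lt_of_pos j hp'
    refine ⟨(j % p).toNat, by omega, ?_⟩
    rw [Int.toNat_of_nonneg h0]
    rwa [← Int.emod_add_mul_ediv j p, ← zpow_smul_zpow_smul, zpow_mul_smul_of_fixed hx] at hj
  have hVinv : (fun x : X => s • x) ⁻¹' V = V := by
    ext x
    rw [mem_preimage, hVmem, hVmem, hPinv]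
    refine and_congr_right fun _ => ⟨fun ⟨j, hj⟩ => ?_, fun ⟨j, hj⟩ => ?_⟩
    · rw [zpow_smul_smul] at hj
      exact ⟨j + 1, hj⟩
    · refine ⟨j - 1, ?_⟩
      rwa [zpow_smul_smul, sub_add_cancel]
  have hVlt : μ V < 1 := by
    refine lt_of_le_of_lt ?_ hC1
    refine (measure_mono inter_subset_right).trans ((measure_biUnion_finset_le _ _).trans ?_)
    have : ∀ j ∈ Finset.range p, μ ((fun x : X => s ^ (j : ℤ) • x) ⁻¹' C) = μ C := fun j _ =>
      (measurePreserving_smul_mp (s ^ (j : ℤ))).measure_preimage hC.nullMeasurableSet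
    rw [Finset.sum_congr rfl this, Finset.sum_const, Finset.card_range, nsmul_eq_mul]
  have hVpos : μ V ≠ 0 := by
    intro hV
    apply hC0
    have hsub : C ⊆ V ∪ Pᶜ := by
      intro x hx
      by_cases hxP : x ∈ P
      · exact Or.inl ((hVmem x).2 ⟨hxP, 0, by simpa using hx⟩)
      · exact Or.inr hxP
    exact measure_mono_null hsub (measure_union_null hV ((prob_compl_eq_zero_iff hPm).2 h))
  rcases hs.prob_eq_zero_or_one hVm hVinv with h1 | h1
  · exact hVpos h1
  · exact hVlt.ne h1

variable {X : Type*} [MeasurableSpace X] [StandardBorelSpace X] {μ : Measure X}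
  [IsProbabilityMeasure μ]

/-- The singularity of the spectrum of a skew product over `s` which is periodic over the periodic
points of `s` and agrees elsewhere with an automorphism with singular spectrum. -/
theorem hasSingularSpectrum_of_agree {s : MPEquiv μ} {G T : MPEquiv (μ.prod μ)}
    (hG : IsOver G s) (hT : IsOver T s) (hTs : HasSingularSpectrum (Aut.mk T))
    (hper : ∀ z : X × X, z.1 ∈ perSet s → ∃ q : ℕ, 0 < q ∧ G ^ (q : ℤ) • z = z)
    (hGT : ∀ z : X × X, z.1 ∉ perSet s → G • z = T • z) : HasSingularSpectrum (Aut.mk G) := by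
  have hGTpow : ∀ (k : ℤ) (z : X × X), z.1 ∉ perSet s → G ^ k • z = T ^ k • z := by
    intro k
    induction k using Int.induction_on with
    | zero => intro z _; rw [zpow_zero, zpow_zero]
    | succ n ih =>
      intro z hz
      rw [zpow_add_one, zpow_add_one, mul_smul, mul_smul, hGT z hz, ih]
      rwa [hT, smul_mem_perSet]
    | pred n ih =>
      intro z hz
      have h1 : (T⁻¹ • z).1 ∉ perSet s := by
        rw [hT.inv z, ← smul_mem_perSet s, smul_inv_smul]
        exact hz
      have h2 : G⁻¹ • z = T⁻¹ • z := by
        rw [inv_smul_eq_iff, hGT _ h1, smul_inv_smul]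
      rw [zpow_sub_one, zpow_sub_one, mul_smul, mul_smul, h2, ih _ h1]
  -- V 0 is the part over aperiodic points, where G has the correlations of T; V (q+1) is the fixed
  -- set of G^(q+1), whose subsets have G^(q+1)-invariant indicators.
  let V : ℕ → Set (X × X) := fun q =>
    Nat.casesOn q (Prod.fst ⁻¹' (perSet s)ᶜ) fun q => {z | G ^ ((q + 1 : ℕ) : ℤ) • z = z}
  refine hasSingularSpectrum_of_iUnion (V := V) (fun q => ?_) (eq_univ_of_forall fun z => ?_) ?_
  · cases q with
    | zero => exact measurable_fst (measurableSet_perSet s).compl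
    | succ q => exact measurableSet_fixed _
  · rw [mem_iUnion]
    by_cases hz : z.1 ∈ perSet s
    · obtain ⟨q, hq, hqz⟩ := hper z hz
      obtain ⟨k, rfl⟩ : ∃ k, q = k + 1 := ⟨q - 1, by omega⟩
      exact ⟨k + 1, hqz⟩
    · exact ⟨0, hz⟩
  · intro q C hC hCV
    cases q with
    | zero =>
      obtain ⟨σ, ⟨hσ, hs⟩, hsing⟩ := hTs (ind (μ.prod μ) hC)
      refine singVec_koopman_iff.2 ⟨σ, ⟨hσ, fun k => ?_⟩, hsing⟩
      rw [hs, ← Aut.mk_zpow, ← Aut.mk_zpow, koopman_ind, koopman_ind]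
      congr 1
      refine ind_congr _ _ (Set.ext fun z => ?_)
      by_cases hz : z.1 ∈ perSet s
      · have h1 : ∀ {F : MPEquiv (μ.prod μ)}, IsOver F s → F ^ k • z ∉ C := by
          intro F hF h
          have h2 : (F ^ k • z).1 ∉ perSet s := hCV h
          rw [hF.zpow k z, zpow_smul_mem_perSet] at h2
          exact h2 hz
        exact ⟨fun h => absurd h (h1 hT), fun h => absurd h (h1 hG)⟩
      · rw [mem_preimage, mem_preimage, hGTpow k z hz]
    | succ q =>
      refine singVec_of_pow_fixed q.succ_pos ?_
      rw [koopmanUnitary_zpow_apply, ← Aut.mk_zpow, koopman_ind]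
      refine ind_congr _ _ (Set.ext fun z => ?_)
      rw [mem_preimage]
      constructor
      · intro h
        have h1 : G ^ ((q + 1 : ℕ) : ℤ) • G ^ ((q + 1 : ℕ) : ℤ) • z = G ^ ((q + 1 : ℕ) : ℤ) • z :=
          hCV h
        have h2 := smul_left_cancel _ h1
        change G ^ ((q + 1 : ℕ) : ℤ) • z ∈ C at h
        rwa [h2] at h
      · intro h
        have h1 : G ^ ((q + 1 : ℕ) : ℤ) • z = z := hCV h
        change G ^ ((q + 1 : ℕ) : ℤ) • z ∈ C
        rwa [h1]

/-- The periodic modification Q over `perSet s` is glued to a conjugate T of s × Id elsewhere; each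
contributes at most 1/n to the disagreement with E. -/
theorem exists_singular_modification {s : MPEquiv μ} (hs : HasSingularSpectrum (Aut.mk s))
    {E : MPEquiv (μ.prod μ)} (hE : IsOver E s) {n : ℕ} (hn : 0 < n) :
    ∃ G : MPEquiv (μ.prod μ), IsOver G s ∧ HasSingularSpectrum (Aut.mk G) ∧
      (μ.prod μ).real {z | E • z ≠ G • z} ≤ 2 / n := by
  classical
  obtain ⟨J, hJ, N, hN, hNμ, hJE⟩ := exists_conj_prodOne hE hn
  obtain ⟨Q, hQ, hQper, hQE⟩ := exists_periodic_modification hE hn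
  set T := J⁻¹ * prodOne s * J with hTdef
  have hT : IsOver T s := by
    have := (hJ.inv.mul (isOver_prodOne s)).mul hJ
    rwa [inv_one, one_mul, mul_one] at this
  have hTs : HasSingularSpectrum (Aut.mk T) := (hasSingularSpectrum_prodOne hs).conj (Aut.mk J)
  let F : Bool → MPEquiv (μ.prod μ) := fun b => bif b then Q else T
  have hF : ∀ b, IsOver (F b) s := fun b => by cases b <;> assumption
  let κ : X → Bool := fun x => if x ∈ perSet s then true else false
  have hκ : Measurable κ :=
    Measurable.ite (measurableSet_perSet s) measurable_const measurable_const
  obtain ⟨G, hG, hGF⟩ := exists_piecewise_over hF hκ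
  have hGQ : ∀ z : X × X, z.1 ∈ perSet s → G • z = Q • z := fun z hz => by
    rw [hGF, show κ z.1 = true from if_pos hz]; rfl
  have hGT : ∀ z : X × X, z.1 ∉ perSet s → G • z = T • z := fun z hz => by
    rw [hGF, show κ z.1 = false from if_neg hz]; rfl
  refine ⟨G, hG, hasSingularSpectrum_of_agree hG hT hTs (fun z hz => ?_) hGT, ?_⟩
  · obtain ⟨q, hq, hqz⟩ := hQper z hz
    have hiter : ∀ i : ℕ, G ^ (i : ℤ) • z = (fun w : X × X => Q • w)^[i] z := by
      intro i
      induction i with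
      | zero => simp
      | succ i ih =>
        rw [Function.iterate_succ_apply', ← ih, ← hGQ, smul_zpow_smul]
        · push_cast; rfl
        · rwa [hG.zpow _ z, zpow_smul_mem_perSet]
    exact ⟨q, hq, (hiter q).trans hqz⟩
  · have hsub : {z : X × X | E • z ≠ G • z} ⊆ {z | Q • z ≠ E • z} ∪ N ×ˢ univ := by
      intro z hz
      by_contra hcon
      simp only [mem_union, mem_prod, mem_univ, and_true, not_or, mem_ofPred_eq, not_not] at hcon
      apply hz
      by_cases hzp : z.1 ∈ perSet s
      · rw [hGQ z hzp, hcon.1]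
      · rw [hGT z hzp, hJE z hzp hcon.2]
    have hNX : (μ.prod μ).real (N ×ˢ univ) = μ.real N := by
      rw [measureReal_prod_prod]; simp
    calc (μ.prod μ).real {z | E • z ≠ G • z}
        ≤ (μ.prod μ).real {z | Q • z ≠ E • z} + (μ.prod μ).real (N ×ˢ univ) :=
          (measureReal_mono hsub).trans (measureReal_union_le _ _)
      _ ≤ 1 / n + 1 / n := by rw [hNX]; exact add_le_add hQE hNμ
      _ = 2 / n := by ring

theorem exists_nat_twelve_div_lt {ε : ℝ} (hε : 0 < ε) : ∃ n : ℕ, 0 < n ∧ 6 * (2 / (n : ℝ)) < ε := by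
  obtain ⟨n, hn⟩ := exists_nat_gt (12 / ε)
  have hn0 : (0 : ℝ) < n := (by positivity : (0 : ℝ) < 12 / ε).trans hn
  refine ⟨n, by exact_mod_cast hn0, ?_⟩
  rw [div_lt_iff₀ hε] at hn
  rw [← mul_div_assoc, div_lt_iff₀ hn0]
  linarith

theorem exists_singular_near (A : ℕ → Set (X × X)) {S : Aut μ} (hS : HasSingularSpectrum S)
    {R : Aut (μ.prod μ)} (hR : R ∈ Ext S) {ε : ℝ} (hε : 0 < ε) :
    ∃ R' ∈ Ext S, HasSingularSpectrum R' ∧ halmosDist A R R' < ε := by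
  obtain ⟨s, rfl⟩ := S.exists_rep
  obtain ⟨E, rfl, hE⟩ := exists_isOver_of_mem_Ext hR
  obtain ⟨n, hn, hnε⟩ := exists_nat_twelve_div_lt hε
  obtain ⟨G, hG, hGs, hEG⟩ := exists_singular_modification hS hE hn
  exact ⟨Aut.mk G, hG.mk_mem_Ext, hGs, (halmosDist_mk_le E G hEG).trans_lt hnε⟩

theorem exists_conj_near [NullSingletonClass μ] (A : ℕ → Set (X × X)) {S : Aut μ}
    (hS : Ergodic S μ) {R : Aut (μ.prod μ)} (hR : R ∈ Ext S) {ε : ℝ} (hε : 0 < ε) :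
    ∃ J ∈ Ext (1 : Aut μ), halmosDist A R (J⁻¹ * prodId S * J) < ε := by
  have hSrep : Aut.mk S.rep = S := S.mk_rep
  rw [← hSrep] at hR
  obtain ⟨E, rfl, hE⟩ := exists_isOver_of_mem_Ext hR
  obtain ⟨n, hn, hnε⟩ := exists_nat_twelve_div_lt hε
  obtain ⟨J, hJ, N, hN, hNμ, hJE⟩ := exists_conj_prodOne hE hn
  refine ⟨Aut.mk J, hJ.mk_mem_Ext, ?_⟩
  rw [← hSrep, prodId_mk, ← Aut.mk_inv, ← Aut.mk_mul, ← Aut.mk_mul]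
  refine (halmosDist_mk_le E _ (δ := 2 / n) ?_).trans_lt hnε
  have hsub : {z : X × X | E • z ≠ (J⁻¹ * prodOne S.rep * J) • z} ⊆ (perSet S.rep ∪ N) ×ˢ univ := by
    intro z hz
    by_contra hcon
    simp only [mem_union, mem_prod, mem_univ, and_true, not_or] at hcon
    exact hz (hJE z hcon.1 hcon.2).symm
  have h0 : μ.real (perSet S.rep) = 0 := by
    rw [Measure.real, measure_perSet_eq_zero hS, ENNReal.toReal_zero]
  calc (μ.prod μ).real {z | E • z ≠ (J⁻¹ * prodOne S.rep * J) • z}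
      ≤ (μ.prod μ).real ((perSet S.rep ∪ N) ×ˢ univ) := measureReal_mono hsub
    _ = μ.real (perSet S.rep ∪ N) := by rw [measureReal_prod_prod]; simp
    _ ≤ μ.real (perSet S.rep) + μ.real N := measureReal_union_le _ _
    _ ≤ 2 / n := by
      rw [h0, zero_add]
      exact hNμ.trans (by gcongr; norm_num)

end Density

end ErgodicExt

/-! ### The theorem -/

theorem mainTheorem2 {X : Type*} [MeasurableSpace X] [StandardBorelSpace X]
    (μ : Measure X) [IsProbabilityMeasure μ] [NullSingletonClass μ]
    (A : ℕ → Set (X × X)) (hA : (μ.prod μ).MeasureDense (Set.range A)) :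
    letI : PseudoMetricSpace (ErgodicExt.Aut (μ.prod μ)) := ErgodicExt.halmosMetric A
    IsGδ {R : ErgodicExt.Aut (μ.prod μ) | ErgodicExt.HasSingularSpectrum R} ∧
    ∀ S : ErgodicExt.Aut μ, ErgodicExt.HasSingularSpectrum S →
      (∃ W : Set (ErgodicExt.Ext S), IsGδ W ∧ Dense W ∧
        ∀ R ∈ W, ErgodicExt.HasSingularSpectrum R.1) ∧
      (∀ J ∈ ErgodicExt.Ext (1 : ErgodicExt.Aut μ),
        J⁻¹ * ErgodicExt.prodId S * J ∈ ErgodicExt.Ext S ∧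
        ErgodicExt.HasSingularSpectrum (J⁻¹ * ErgodicExt.prodId S * J)) ∧
      (Ergodic S μ →
        Dense {R : ErgodicExt.Ext S | ∃ J ∈ ErgodicExt.Ext (1 : ErgodicExt.Aut μ),
          R.1 = J⁻¹ * ErgodicExt.prodId S * J}) := by
  let _ : PseudoMetricSpace (ErgodicExt.Aut (μ.prod μ)) := ErgodicExt.halmosMetric A
  have hGδ : IsGδ {R : ErgodicExt.Aut (μ.prod μ) | ErgodicExt.HasSingularSpectrum R} :=
    ErgodicExt.isGδ_hasSingularSpectrum hA
  have hmem : ∀ S : ErgodicExt.Aut μ, ∀ J ∈ ErgodicExt.Ext (1 : ErgodicExt.Aut μ),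
      J⁻¹ * ErgodicExt.prodId S * J ∈ ErgodicExt.Ext S := by
    intro S J hJ
    obtain ⟨s, rfl⟩ := S.exists_rep
    exact ErgodicExt.conj_prodId_mem_Ext s hJ
  refine ⟨hGδ, fun S hS => ⟨?_, fun J hJ => ⟨hmem S J hJ, ?_⟩, fun hSe => ?_⟩⟩
  -- W is the trace of Sing on Ext(S); only its density requires the modifications.
  · refine ⟨Subtype.val ⁻¹' {R | ErgodicExt.HasSingularSpectrum R},
      hGδ.preimage continuous_subtype_val, Metric.dense_iff.2 fun R ε hε => ?_, fun R hR => hR⟩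
    obtain ⟨R', hR', hs, hd⟩ := ErgodicExt.exists_singular_near A hS R.2 hε
    exact ⟨⟨R', hR'⟩, Metric.mem_ball'.2 hd, hs⟩
  · refine ErgodicExt.HasSingularSpectrum.conj ?_ J
    obtain ⟨s, rfl⟩ := S.exists_rep
    rw [ErgodicExt.prodId_mk]
    exact ErgodicExt.hasSingularSpectrum_prodOne hS
  · refine Metric.dense_iff.2 fun R ε hε => ?_
    obtain ⟨J, hJ, hd⟩ := ErgodicExt.exists_conj_near A hSe R.2 hε
    exact ⟨⟨_, hmem S J hJ⟩, Metric.mem_ball'.2 hd, J, hJ, rfl⟩
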